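/- An edge-ordered graph is a finite graph with a non-empty vertex set, together with a total order of its edge set; an injective labeling $L\colon E(G)\to\mathbb R$ induces the order in which $e<e'$ if and only if $L(e)<L(e')$. A copy of $F$ in $G$ is the image of $F$ under an injective map $V(F)\to V(G)$ that sends edges to edges and satisfies: if $e<e'$ in $F$, then the image of $e$ is smaller than the image of $e'$ in $G$. An edge-ordered graph $F$ on $f$ vertices is tileable if there is an integer $t\ge 1$ divisible by $f$ such that every edge-ordering of the complete graph $K_t$ contains a perfect $F$-tiling, i.e. a collection of pairwise vertex-disjoint copies of $F$ covering all vertices of $K_t$. For $n\ge 0$, let $K_{n+1}$ have vertex set $\{x,v_1,\dots,v_n\}$. A $\star$-canonical ordering of $K_{n+1}$ is the edge-ordering induced by an injective labeling $L\colon E(K_{n+1})\to\mathbb R$ with the following two properties. (a) One of the following four rules holds for all $1\le i<j\le n$: - $L(v_iv_j)=2ni+j-1$ (min), - $L(v_iv_j)=(2n-1)j+i$ (max), - $L(v_iv_j)=(2n+1)i-j$ (inverse min), - $L(v_iv_j)=2nj-i+n$ (inverse max). (b) The labels $x_k=L(xv_k)$, $1\le k\le n$, satisfy one of the following five conditions: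 - $x_1<x_2<\dots<x_n$, and $x_k>L(v_iv_j)$ for all $k$ and all $i<j$ (larger increasing), - $x_1>x_2>\dots>x_n$, and $x_k>L(v_iv_j)$ for all $k$ and all $i<j$ (larger decreasing), - $x_1<x_2<\dots<x_n$, and $x_k<L(v_iv_j)$ for all $k$ and all $i<j$ (smaller increasing), - $x_1>x_2>\dots>x_n$, and $x_k<L(v_iv_j)$ for all $k$ and all $i<j$ (smaller decreasing), - $x_k=2nk$ for all $k$ (middle increasing). The choices in (a) and (b) give twenty types, and each type determines one $\star$-canonical ordering of $K_{n+1}$ (for small $n$ some of the twenty coincide). **Theorem (Tileable characterization).** An edge-ordered graph $F$ on $f\ge 1$ vertices is tileable if and only if each of the twenty $\star$-canonical orderings of $K_f$ contains a copy of $F$. -/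

import Mathlib

/-- An edge-ordered graph on the vertex set `V`: a graph together with a total order of its
edge set. -/
structure EdgeOrderedGraph (V : Type*) where
  graph : SimpleGraph V
  edgeOrder : LinearOrder graph.edgeSet

namespace EdgeOrderedGraph

/-- `e` is smaller than `e'` in the total order that `G` carries. This names the order explicitly,
since Mathlib also has an unrelated partial order on unordered pairs. -/
def EdgeLT {V : Type*} (G : EdgeOrderedGraph V) (e e' : G.graph.edgeSet) : Prop :=
  G.edgeOrder.lt e e'

/-- The edge-ordered graph whose edge-ordering is induced by an injective labeling of the edges by
real numbers: `e < e'` if and only if `L e < L e'`. -/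
noncomputable def ofLabeling {V : Type*} (G : SimpleGraph V) (L : G.edgeSet → ℝ)
    (hL : Function.Injective L) : EdgeOrderedGraph V where
  graph := G
  edgeOrder := LinearOrder.lift' L hL

/-- An embedding of `F` into `G`: an injective map of the vertices that sends edges to edges and
respects the order of the edges. Its image is a copy of `F` in `G`. -/
structure Embedding {V W : Type*} (F : EdgeOrderedGraph V) (G : EdgeOrderedGraph W) where
  toHom : F.graph →g G.graph
  injective : Function.Injective toHom
  map_lt : ∀ e e' : F.graph.edgeSet, F.EdgeLT e e' →
    G.EdgeLT (toHom.mapEdgeSet e) (toHom.mapEdgeSet e')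

/-- The vertex set of the copy of `F` given by an embedding. -/
def Embedding.verts {V W : Type*} {F : EdgeOrderedGraph V} {G : EdgeOrderedGraph W}
    (φ : Embedding F G) : Set W :=
  Set.range φ.toHom

/-- `G` contains a copy of `F`. -/
def Contains {V W : Type*} (G : EdgeOrderedGraph W) (F : EdgeOrderedGraph V) : Prop :=
  Nonempty (Embedding F G)

/-- `G` contains a perfect `F`-tiling: a collection of pairwise vertex-disjoint copies of `F` that
together cover all the vertices of `G`. -/
def HasPerfectTiling {V W : Type*} (G : EdgeOrderedGraph W) (F : EdgeOrderedGraph V) : Prop :=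
  ∃ T : Set (Embedding F G),
    T.PairwiseDisjoint Embedding.verts ∧ ⋃ φ ∈ T, φ.verts = Set.univ

/-- `F` on `f` vertices is tileable if for some positive `t` divisible by `f` every edge-ordering
of the complete graph `K_t` contains a perfect `F`-tiling. -/
def Tileable {V : Type*} [Fintype V] (F : EdgeOrderedGraph V) : Prop :=
  ∃ t : ℕ, 0 < t ∧ Fintype.card V ∣ t ∧
    ∀ o : LinearOrder (⊤ : SimpleGraph (Fin t)).edgeSet,
      HasPerfectTiling (⟨⊤, o⟩ : EdgeOrderedGraph (Fin t)) F

end EdgeOrderedGraph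

/-- The four types of canonical orderings. -/
inductive CanonicalType
  | min
  | max
  | invMin
  | invMax

/-- The standard labelings: the label of the edge `v_i v_j` of the complete graph on
`v_1, …, v_n`, where `1 ≤ i < j ≤ n`. -/
def CanonicalType.label (n : ℕ) : CanonicalType → ℕ → ℕ → ℝ
  | .min, i, j => 2 * (n : ℝ) * i + j - 1
  | .max, i, j => (2 * (n : ℝ) - 1) * j + i
  | .invMin, i, j => (2 * (n : ℝ) + 1) * i - j
  | .invMax, i, j => 2 * (n : ℝ) * j - i + n

/-- The five ways in which the edges at the special vertex are placed. -/
inductive SpecialType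
  | largerIncreasing
  | largerDecreasing
  | smallerIncreasing
  | smallerDecreasing
  | middleIncreasing

/-- The condition on the labels `X i` of the edges `x v_i` at the special vertex, given the labels
`A i j` (for `i < j`) of the edges `v_i v_j`. Here `i : Fin n` stands for the index
`i + 1` in `1, …, n`. -/
def SpecialType.Holds {n : ℕ} (X : Fin n → ℝ) (A : Fin n → Fin n → ℝ) : SpecialType → Prop
  | .largerIncreasing => StrictMono X ∧ ∀ k i j, i < j → A i j < X k
  | .largerDecreasing => StrictAnti X ∧ ∀ k i j, i < j → A i j < X k
  | .smallerIncreasing => StrictMono X ∧ ∀ k i j, i < j → X k < A i j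
  | .smallerDecreasing => StrictAnti X ∧ ∀ k i j, i < j → X k < A i j
  | .middleIncreasing => ∀ i, X i = 2 * (n : ℝ) * ((i : ℕ) + 1)

/-- The complete graph `K_{n+1}` on the vertices `x, v_1, …, v_n`, where `none` is `x` and
`some i` is `v_{i+1}`. -/
abbrev starGraph (n : ℕ) : SimpleGraph (Option (Fin n)) := ⊤

/-- `L` is a labeling of `K_{n+1}` that induces the `⋆`-canonical ordering of type `(c, p)`, with
special vertex `none`: it is the standard labeling of type `c` on the edges `v_i v_j`, and the
labels of the edges at the special vertex are placed according to `p`. -/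
def IsStarCanonical {n : ℕ} (c : CanonicalType) (p : SpecialType)
    (L : (starGraph n).edgeSet → ℝ) : Prop :=
  (∀ (i j : Fin n) (h : i < j),
    L ⟨s(some i, some j), by simpa using h.ne⟩ = c.label n (i + 1) (j + 1)) ∧
  p.Holds (fun i => L ⟨s(none, some i), by simp⟩) (fun i j => c.label n (i + 1) (j + 1))

/-! Write f = n + 1. The argument uses only how edges compare, never the labels themselves. In a
⋆-canonical order the type determines all comparisons. In the middle type the edge xv_k compares
with the other edges as the degenerate pair (k, k) would. Hence any subset containing x inherits a
⋆-canonical order of the same type, and two such orders of equal size contain the same F.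

Necessity: order K_t ⋆-canonically. The tile covering x uses x and n further vertices, and these
span the ⋆-canonical K_f of the given type (`IsCopy.transfer`).

Sufficiency is an absorption argument. Ramsey's theorem gives a large canonically ordered set I
(`exists_canonOn`). A canonical order is ⋆-canonical with an end vertex as special vertex, so any f
vertices of I span a copy of F. Outside I, copies are removed greedily until boundedly many vertices
U remain. Each x in U is then covered together with n vertices of I: after a further use of Ramsey,
the edges from x to I lie above all others, below all others, or interleave with them. In the last
case they are either of middle type or make x a new first or last vertex of the canonical order
(`CanonOn.starOn_or_insert_of_homogeneous`). In every case x and n vertices of I form a ⋆-canonical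
K_f. The rest of I has size divisible by f and is cut into blocks of f vertices. -/

open Finset

/-! ### Ramsey theory -/

/-- Finite Ramsey theorem for colorings of the increasing lists of length `k`. -/
theorem exists_homogeneous_list {α κ : Type*} [LinearOrder α] [Finite κ] (k m : ℕ) :
    ∃ N, ∀ (χ : List α → κ) (S : Finset α), N ≤ #S → ∃ T ⊆ S, #T = m ∧ ∃ c, ∀ l : List α,
      l.length = k → l.Pairwise (· < ·) → (∀ x ∈ l, x ∈ T) → χ l = c := by
  classical
  induction k generalizing m with
  | zero =>
    refine ⟨m, fun χ S hS => ?_⟩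
    obtain ⟨T, hT, hm⟩ := exists_subset_card_eq hS
    refine ⟨T, hT, hm, χ [], fun l hl _ _ => ?_⟩
    rw [List.length_eq_zero_iff.1 hl]
  | succ k ih =>
    -- Thin out S until the color of an increasing list depends only on its first element; each new
    -- minimum is made homogeneous by the induction hypothesis for `k`. Pigeonhole on the first
    -- elements then finishes.
    have key : ∀ p, ∃ N, ∀ (χ : List α → κ) (S : Finset α), N ≤ #S → ∃ T ⊆ S, #T = p ∧
        ∃ γ : α → κ, ∀ a l, l.length = k → (a :: l).Pairwise (· < ·) →
          (∀ x ∈ a :: l, x ∈ T) → χ (a :: l) = γ a := by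
      intro p
      induction p with
      | zero =>
        exact ⟨0, fun χ S _ => ⟨∅, empty_subset _, rfl, fun _ => χ [], fun a l _ _ h =>
          absurd (h a (by simp)) (by simp)⟩⟩
      | succ p ihp =>
        obtain ⟨N₀, h₀⟩ := ihp
        obtain ⟨N₁, h₁⟩ := ih N₀
        refine ⟨N₁ + 1, fun χ S hS => ?_⟩
        have hne : S.Nonempty := card_pos.1 (by omega)
        set a := S.min' hne
        have ha : a ∈ S := S.min'_mem hne
        obtain ⟨S', hS', hc', c, hc⟩ := h₁ (fun l => χ (a :: l)) (S.erase a)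
          (by rw [card_erase_of_mem ha]; omega)
        obtain ⟨T, hT, hTp, γ, hγ⟩ := h₀ χ S' hc'.ge
        have haT : a ∉ T := fun h => notMem_erase a S (hS' (hT h))
        refine ⟨insert a T, insert_subset ha ((hT.trans hS').trans (erase_subset _ _)),
          by rw [card_insert_of_notMem haT, hTp], Function.update γ a c, fun b l hl hp hm => ?_⟩
        have hgt : ∀ x ∈ l, x ∈ T := by
          intro x hx
          have hbx : b < x := (List.pairwise_cons.1 hp).1 x hx
          refine (mem_insert.1 (hm x (by simp [hx]))).resolve_left ?_
          rintro rfl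
          rcases mem_insert.1 (hm b (by simp)) with h | h
          · exact absurd h hbx.ne
          · exact absurd (S.min'_le b ((erase_subset _ _) (hS' (hT h)))) hbx.not_ge
        rcases mem_insert.1 (hm b (by simp)) with h | h
        · subst h
          rw [Function.update_self]
          exact hc l hl (List.pairwise_cons.1 hp).2 fun x hx => hT (hgt x hx)
        · rw [Function.update_of_ne (fun e : b = a => haT (e ▸ h))]
          exact hγ b l hl hp fun x hx => by
            rcases List.mem_cons.1 hx with rfl | hx
            exacts [h, hgt x hx]
    have := Fintype.ofFinite κ
    obtain ⟨N, hN⟩ := key (Fintype.card κ * m)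
    refine ⟨N, fun χ S hS => ?_⟩
    obtain ⟨T, hT, hTc, γ, hγ⟩ := hN χ S hS
    have : Nonempty κ := ⟨χ []⟩
    obtain ⟨c, -, hc⟩ := exists_le_card_fiber_of_mul_le_card_of_maps_to (s := T)
      (t := (univ : Finset κ)) (f := γ) (n := m) (fun _ _ => mem_univ _) univ_nonempty
      (by rw [hTc, card_univ])
    obtain ⟨T', hT', hm⟩ := exists_subset_card_eq hc
    refine ⟨T', hT'.trans ((filter_subset _ _).trans hT), hm, c, fun l hl hp hmem => ?_⟩
    obtain _ | ⟨a, l⟩ := l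
    · simp at hl
    · rw [hγ a l (by simpa using hl) hp fun x hx => (mem_filter.1 (hT' (hmem x hx))).1]
      exact (mem_filter.1 (hT' (hmem a (by simp)))).2

/-- The color of a list is the vector of truth values of all `r` predicates, so a single application
makes them homogeneous simultaneously. The value at lists of another length is never used. -/
theorem exists_homogeneous_pairs {α : Type*} [LinearOrder α] (r m : ℕ) :
    ∃ N, ∀ (P : Fin r → α → α → Prop) (S : Finset α), N ≤ #S → ∃ T ⊆ S, #T = m ∧ ∀ b,
      (∀ i ∈ T, ∀ j ∈ T, i < j → P b i j) ∨ (∀ i ∈ T, ∀ j ∈ T, i < j → ¬ P b i j) := by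
  obtain ⟨N, hN⟩ := exists_homogeneous_list (α := α) (κ := Fin r → Prop) 2 m
  refine ⟨N, fun P S hS => ?_⟩
  obtain ⟨T, hT, hm, c, hc⟩ := hN (fun l => match l with
    | [i, j] => fun b => P b i j
    | _ => fun _ => True) S hS
  have h : ∀ b, ∀ i ∈ T, ∀ j ∈ T, i < j → P b i j = c b := fun b i hi j hj hij =>
    congrFun (hc [i, j] rfl (by simp [hij]) (by simp [hi, hj])) b
  refine ⟨T, hT, hm, fun b => ?_⟩
  by_cases hb : c b
  · exact .inl fun i hi j hj hij => (h b i hi j hj hij).symm ▸ hb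
  · exact .inr fun i hi j hj hij => (h b i hi j hj hij).symm ▸ hb

theorem exists_homogeneous_triples {α : Type*} [LinearOrder α] (r m : ℕ) :
    ∃ N, ∀ (P : Fin r → α → α → α → Prop) (S : Finset α), N ≤ #S → ∃ T ⊆ S, #T = m ∧ ∀ b,
      (∀ i ∈ T, ∀ j ∈ T, ∀ k ∈ T, i < j → j < k → P b i j k) ∨
      (∀ i ∈ T, ∀ j ∈ T, ∀ k ∈ T, i < j → j < k → ¬ P b i j k) := by
  obtain ⟨N, hN⟩ := exists_homogeneous_list (α := α) (κ := Fin r → Prop) 3 m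
  refine ⟨N, fun P S hS => ?_⟩
  obtain ⟨T, hT, hm, c, hc⟩ := hN (fun l => match l with
    | [i, j, k] => fun b => P b i j k
    | _ => fun _ => True) S hS
  have h : ∀ b, ∀ i ∈ T, ∀ j ∈ T, ∀ k ∈ T, i < j → j < k → P b i j k = c b :=
    fun b i hi j hj k hk hij hjk =>
      congrFun (hc [i, j, k] rfl (by simp [hij, hjk, hij.trans hjk]) (by simp [hi, hj, hk])) b
  refine ⟨T, hT, hm, fun b => ?_⟩
  by_cases hb : c b
  · exact .inl fun i hi j hj k hk hij hjk => (h b i hi j hj k hk hij hjk).symm ▸ hb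
  · exact .inr fun i hi j hj k hk hij hjk => (h b i hi j hj k hk hij hjk).symm ▸ hb

theorem exists_homogeneous_quadruples {α : Type*} [LinearOrder α] (m : ℕ) :
    ∃ N, ∀ (P : α → α → α → α → Prop) (S : Finset α), N ≤ #S → ∃ T ⊆ S, #T = m ∧
      ((∀ i ∈ T, ∀ j ∈ T, ∀ k ∈ T, ∀ l ∈ T, i < j → j < k → k < l → P i j k l) ∨
      (∀ i ∈ T, ∀ j ∈ T, ∀ k ∈ T, ∀ l ∈ T, i < j → j < k → k < l → ¬ P i j k l)) := by
  obtain ⟨N, hN⟩ := exists_homogeneous_list (α := α) (κ := Prop) 4 m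
  refine ⟨N, fun P S hS => ?_⟩
  obtain ⟨T, hT, hm, c, hc⟩ := hN (fun l => match l with
    | [i, j, k, l] => P i j k l
    | _ => True) S hS
  have h : ∀ i ∈ T, ∀ j ∈ T, ∀ k ∈ T, ∀ l ∈ T, i < j → j < k → k < l → P i j k l = c :=
    fun i hi j hj k hk l hl hij hjk hkl =>
      hc [i, j, k, l] rfl (by simp [hij, hjk, hkl, hij.trans hjk, hjk.trans hkl,
        hij.trans (hjk.trans hkl)]) (by simp [hi, hj, hk, hl])
  refine ⟨T, hT, hm, ?_⟩
  by_cases hb : c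
  · exact .inl fun i hi j hj k hk l hl h1 h2 h3 => (h i hi j hj k hk l hl h1 h2 h3).symm ▸ hb
  · exact .inr fun i hi j hj k hk l hl h1 h2 h3 => (h i hi j hj k hk l hl h1 h2 h3).symm ▸ hb

theorem exists_strictMono_fin_of_le_card {α : Type*} [LinearOrder α] {I : Finset α} {r : ℕ}
    (h : r ≤ #I) : ∃ e : Fin r → α, StrictMono e ∧ ∀ i, e i ∈ I := by
  obtain ⟨J, hJ, hc⟩ := exists_subset_card_eq h
  exact ⟨J.orderEmbOfFin hc, (J.orderEmbOfFin hc).strictMono,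
    fun i => hJ (J.orderEmbOfFin_mem hc i)⟩

/-! ### Canonical orders -/

/-- The comparison of the pairs `i < j` and `k < l` in the canonical order of the given type. -/
def CanonicalType.LT {α : Type*} [LinearOrder α] : CanonicalType → α → α → α → α → Prop
  | .min, i, j, k, l => i < k ∨ i = k ∧ j < l
  | .max, i, j, k, l => j < l ∨ j = l ∧ i < k
  | .invMin, i, j, k, l => i < k ∨ i = k ∧ l < j
  | .invMax, i, j, k, l => j < l ∨ j = l ∧ k < i

theorem CanonicalType.LT.map_iff {α β : Type*} [LinearOrder α] [LinearOrder β] {e : α → β}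
    (he : StrictMono e) (c : CanonicalType) (i j k l : α) :
    c.LT (e i) (e j) (e k) (e l) ↔ c.LT i j k l := by
  cases c <;> simp [CanonicalType.LT, he.lt_iff_lt, he.injective.eq_iff]

/-- Totality is what makes the one-way implication in `CanonOn` sufficient: it leaves no pair of
distinct edges undecided. -/
theorem CanonicalType.LT.trichotomy {α : Type*} [LinearOrder α] (c : CanonicalType)
    (i j k l : α) : c.LT i j k l ∨ (i = k ∧ j = l) ∨ c.LT k l i j := by
  rcases lt_trichotomy i k with h | h | h <;> rcases lt_trichotomy j l with h' | h' | h' <;>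
    cases c <;> simp [CanonicalType.LT, h, h', eq_comm]

/-- A symmetric labeling of the pairs of vertices that separates the edges of the complete
graph. -/
structure IsLabeling {W : Type*} (ℓ : W → W → ℝ) : Prop where
  symm : ∀ a b, ℓ a b = ℓ b a
  inj : ∀ a b c d, a ≠ b → c ≠ d → ℓ a b = ℓ c d → s(a, b) = s(c, d)

/-- The vertices `v i`, `i ∈ I`, are ordered canonically of type `c`. -/
structure CanonOn {α W : Type*} [LinearOrder α] (c : CanonicalType) (ℓ : W → W → ℝ) (v : α → W)
    (I : Finset α) : Prop where
  injOn : Set.InjOn v I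
  lt : ∀ i ∈ I, ∀ j ∈ I, ∀ k ∈ I, ∀ l ∈ I, i < j → k < l → c.LT i j k l →
    ℓ (v i) (v j) < ℓ (v k) (v l)

theorem CanonOn.mono {α W : Type*} [LinearOrder α] {c : CanonicalType} {ℓ : W → W → ℝ}
    {v : α → W} {I J : Finset α} (h : CanonOn c ℓ v I) (hJ : J ⊆ I) : CanonOn c ℓ v J :=
  ⟨h.injOn.mono hJ, fun i hi j hj k hk l hl => h.lt i (hJ hi) j (hJ hj) k (hJ hk) l (hJ hl)⟩

/-- The comparison of nested pairs decides which end dominates: the left one if the outer pair is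
smaller, the right one if it is larger. Four indices suffice to exclude the incompatible choice in
`hb` or `ha` by a cyclic chain of inequalities. The remaining free choice is the tie-break between
pairs with a common dominant end, which gives the type or its inverse. -/
theorem exists_canonical_of_homogeneous {α : Type*} [LinearOrder α] {I : Finset α}
    (hI : 4 ≤ #I) (f : α → α → ℝ)
    (hc : ∀ i ∈ I, ∀ j ∈ I, ∀ k ∈ I, i < j → j < k → f i j < f j k)
    (ha : (∀ i ∈ I, ∀ j ∈ I, ∀ k ∈ I, i < j → j < k → f i j < f i k) ∨
      (∀ i ∈ I, ∀ j ∈ I, ∀ k ∈ I, i < j → j < k → f i k < f i j))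
    (hb : (∀ i ∈ I, ∀ j ∈ I, ∀ k ∈ I, i < j → j < k → f i k < f j k) ∨
      (∀ i ∈ I, ∀ j ∈ I, ∀ k ∈ I, i < j → j < k → f j k < f i k))
    (hg : (∀ i ∈ I, ∀ j ∈ I, ∀ k ∈ I, ∀ l ∈ I, i < j → j < k → k < l → f i l < f j k) ∨
      (∀ i ∈ I, ∀ j ∈ I, ∀ k ∈ I, ∀ l ∈ I, i < j → j < k → k < l → f j k < f i l)) :
    ∃ c : CanonicalType, ∀ i ∈ I, ∀ j ∈ I, ∀ k ∈ I, ∀ l ∈ I, i < j → k < l → c.LT i j k l →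
      f i j < f k l := by
  obtain ⟨e, he, hmem⟩ := exists_strictMono_fin_of_le_card hI
  have h01 : e 0 < e 1 := he (by decide)
  have h12 : e 1 < e 2 := he (by decide)
  have h23 : e 2 < e 3 := he (by decide)
  have m0 := hmem 0
  have m1 := hmem 1
  have m2 := hmem 2
  have m3 := hmem 3
  rcases hg with hg | hg
  · have hb : ∀ i ∈ I, ∀ j ∈ I, ∀ k ∈ I, i < j → j < k → f i k < f j k := by
      rcases hb with hb | hb
      · exact hb
      rcases ha with ha | ha
      · have h1 := hg _ m0 _ m1 _ m2 _ m3 h01 h12 h23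
        have h2 := ha _ m1 _ m2 _ m3 h12 h23
        have h3 := hb _ m0 _ m1 _ m3 h01 (h12.trans h23)
        linarith
      · have h1 := ha _ m0 _ m1 _ m2 h01 h12
        have h2 := hc _ m0 _ m1 _ m2 h01 h12
        have h3 := hb _ m0 _ m1 _ m2 h01 h12
        linarith
    have main : ∀ i ∈ I, ∀ j ∈ I, ∀ k ∈ I, ∀ l ∈ I, i < j → k < l → i < k → f i j < f k l := by
      intro i hi j hj k hk l hl hij hkl hik
      rcases lt_trichotomy j k with h | rfl | h
      · exact (hc i hi j hj k hk hij h).trans (hc j hj k hk l hl h hkl)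
      · exact hc i hi j hj l hl hij hkl
      · rcases lt_trichotomy j l with h' | rfl | h'
        · rcases ha with ha | ha
          · exact (hb i hi k hk j hj hik h).trans (ha k hk j hj l hl h h')
          · exact (ha i hi k hk j hj hik h).trans (hc i hi k hk l hl hik hkl)
        · exact hb i hi k hk j hj hik h
        · exact hg i hi k hk l hl j hj hik hkl h'
    rcases ha with ha | ha
    · refine ⟨.min, fun i hi j hj k hk l hl hij hkl h => ?_⟩
      rcases h with h | ⟨rfl, h⟩
      exacts [main i hi j hj k hk l hl hij hkl h, ha i hi j hj l hl hij h]
    · refine ⟨.invMin, fun i hi j hj k hk l hl hij hkl h => ?_⟩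
      rcases h with h | ⟨rfl, h⟩
      exacts [main i hi j hj k hk l hl hij hkl h, ha i hi l hl j hj hkl h]
  · have ha : ∀ i ∈ I, ∀ j ∈ I, ∀ k ∈ I, i < j → j < k → f i j < f i k := by
      rcases ha with ha | ha
      · exact ha
      rcases hb with hb | hb
      · have h1 := hg _ m0 _ m1 _ m2 _ m3 h01 h12 h23
        have h2 := hb _ m0 _ m1 _ m2 h01 h12
        have h3 := ha _ m0 _ m2 _ m3 (h01.trans h12) h23
        linarith
      · have h1 := ha _ m0 _ m1 _ m2 h01 h12
        have h2 := hc _ m0 _ m1 _ m2 h01 h12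
        have h3 := hb _ m0 _ m1 _ m2 h01 h12
        linarith
    have main : ∀ i ∈ I, ∀ j ∈ I, ∀ k ∈ I, ∀ l ∈ I, i < j → k < l → j < l → f i j < f k l := by
      intro i hi j hj k hk l hl hij hkl hjl
      rcases lt_trichotomy j k with h | rfl | h
      · exact (hc i hi j hj k hk hij h).trans (hc j hj k hk l hl h hkl)
      · exact hc i hi j hj l hl hij hkl
      · rcases lt_trichotomy i k with h' | rfl | h'
        · rcases hb with hb | hb
          · exact (hb i hi k hk j hj h' h).trans (ha k hk j hj l hl h hjl)
          · exact (hc i hi j hj l hl hij hjl).trans (hb k hk j hj l hl h hjl)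
        · exact ha i hi j hj l hl hij hjl
        · exact hg k hk i hi j hj l hl h' hij hjl
    rcases hb with hb | hb
    · refine ⟨.max, fun i hi j hj k hk l hl hij hkl h => ?_⟩
      rcases h with h | ⟨rfl, h⟩
      exacts [main i hi j hj k hk l hl hij hkl h, hb i hi k hk j hj h hkl]
    · refine ⟨.invMax, fun i hi j hj k hk l hl hij hkl h => ?_⟩
      rcases h with h | ⟨rfl, h⟩
      exacts [main i hi j hj k hk l hl hij hkl h, hb k hk i hi j hj h hij]

theorem IsLabeling.ne {α W : Type*} [LinearOrder α] {ℓ : W → W → ℝ} (hℓ : IsLabeling ℓ)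
    {v : α → W} {I : Finset α} (hv : Set.InjOn v I) {i j k l : α} (hi : i ∈ I) (hj : j ∈ I)
    (hk : k ∈ I) (hl : l ∈ I) (hij : i < j) (hkl : k < l) (h : i ≠ k ∨ j ≠ l) :
    ℓ (v i) (v j) ≠ ℓ (v k) (v l) := by
  intro e
  have := hℓ.inj _ _ _ _ (fun h => hij.ne (hv hi hj h)) (fun h => hkl.ne (hv hk hl h)) e
  rcases Sym2.eq_iff.1 this with ⟨h1, h2⟩ | ⟨h1, h2⟩
  · exact h.elim (· (hv hi hk h1)) (· (hv hj hl h2))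
  · have h1 := hv hi hl h1
    have h2 := hv hj hk h2
    subst h1 h2
    exact lt_asymm hij hkl

/-- Every large edge-ordered complete graph contains a large canonically ordered one. -/
theorem exists_canonOn (m : ℕ) : ∃ N, ∀ {W : Type} {ℓ : W → W → ℝ}, IsLabeling ℓ →
    ∀ S : Finset W, N ≤ #S → ∃ (c : CanonicalType) (v : ℤ → W) (I : Finset ℤ), #I = m ∧
      CanonOn c ℓ v I ∧ ∀ i ∈ I, v i ∈ S := by
  classical
  -- The additional 4 provides the indices that `exists_canonical_of_homogeneous` requires.
  obtain ⟨N₄, h₄⟩ := exists_homogeneous_quadruples (α := ℤ) (m + 4)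
  obtain ⟨N₃, h₃⟩ := exists_homogeneous_triples (α := ℤ) 2 N₄
  obtain ⟨N₂, h₂⟩ := exists_homogeneous_triples (α := ℤ) 1 N₃
  refine ⟨N₂ + 1, fun {W ℓ} hℓ S hS => ?_⟩
  obtain ⟨v, I, hIc, hv, hvS, hc⟩ : ∃ (v : ℤ → W) (I : Finset ℤ), #I = N₃ ∧ Set.InjOn v I ∧
      (∀ i ∈ I, v i ∈ S) ∧ ∀ i ∈ I, ∀ j ∈ I, ∀ k ∈ I, i < j → j < k →
        ℓ (v i) (v j) < ℓ (v j) (v k) := by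
    -- `w` is a junk value of `u` at indices beyond the range; the `+ 1` in the bound guarantees
    -- that it exists.
    obtain ⟨w, hw⟩ : S.Nonempty := card_pos.1 (by omega)
    let u : ℤ → W := fun i => if h : i.toNat < #S then (S.equivFin.symm ⟨i.toNat, h⟩ : W) else w
    let I₀ : Finset ℤ := (range #S).map ⟨fun n : ℕ => (n : ℤ), Nat.cast_injective⟩
    have hu : Set.InjOn u I₀ := by
      intro i hi j hj h
      simp only [I₀, coe_map, Set.mem_image, coe_range, Set.mem_Iio, Function.Embedding.coeFn_mk]
        at hi hj
      obtain ⟨i, hi, rfl⟩ := hi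
      obtain ⟨j, hj, rfl⟩ := hj
      simp only [u, Int.toNat_natCast, hi, hj, dite_true] at h
      simpa using S.equivFin.symm.injective (Subtype.ext h)
    have huS : ∀ i, u i ∈ S := by
      intro i
      by_cases h : i.toNat < #S
      · simp only [u, h, dite_true]; exact coe_mem _
      · simpa only [u, h, dite_false] using hw
    obtain ⟨I, hI, hIc, hP⟩ := h₂ (fun _ i j k => ℓ (u i) (u j) < ℓ (u j) (u k)) I₀
      (by simp [I₀]; omega)
    rcases hP 0 with hP | hP
    · exact ⟨u, I, hIc, hu.mono hI, fun i _ => huS i, hP⟩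
    -- If monotone paths descend, reversing the vertex order makes them ascend. Indices in ℤ allow
    -- this by negation.
    · refine ⟨fun i => u (-i), I.map (Equiv.neg ℤ).toEmbedding, by simpa using hIc, ?_,
        fun i _ => huS _, ?_⟩
      · intro i hi j hj h
        simp only [coe_map, Equiv.coe_toEmbedding, Set.mem_image, mem_coe, Equiv.neg_apply]
          at hi hj
        obtain ⟨i, hi, rfl⟩ := hi
        obtain ⟨j, hj, rfl⟩ := hj
        simp only [neg_neg] at h
        rw [hu (hI hi) (hI hj) h]
      · simp only [mem_map, Equiv.coe_toEmbedding, Equiv.neg_apply]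
        rintro _ ⟨i, hi, rfl⟩ _ ⟨j, hj, rfl⟩ _ ⟨k, hk, rfl⟩ hij hjk
        simp only [neg_neg]
        rw [neg_lt_neg_iff] at hij hjk
        have := hP k hk j hj i hi hjk hij
        rw [hℓ.symm (u i) (u j), hℓ.symm (u j) (u k)]
        exact lt_of_le_of_ne (not_lt.1 this)
          (hℓ.ne hu (hI hj) (hI hi) (hI hk) (hI hj) hij hjk (.inl hjk.ne'))
  obtain ⟨I₁, hI₁, hI₁c, hP⟩ := h₃ (![fun i j k => ℓ (v i) (v j) < ℓ (v i) (v k),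
    fun i j k => ℓ (v i) (v k) < ℓ (v j) (v k)]) I hIc.ge
  obtain ⟨I₂, hI₂, hI₂c, hQ⟩ := h₄ (fun i j k l => ℓ (v i) (v l) < ℓ (v j) (v k)) I₁ hI₁c.ge
  have hs : I₂ ⊆ I := hI₂.trans hI₁
  obtain ⟨c, hlt⟩ := exists_canonical_of_homogeneous (I := I₂) (by omega)
    (fun i j => ℓ (v i) (v j))
    (fun i hi j hj k hk => hc i (hs hi) j (hs hj) k (hs hk))
    ((hP 0).imp (fun h i hi j hj k hk => h i (hI₂ hi) j (hI₂ hj) k (hI₂ hk))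
      (fun h i hi j hj k hk hij hjk => lt_of_le_of_ne
        (not_lt.1 (h i (hI₂ hi) j (hI₂ hj) k (hI₂ hk) hij hjk))
        (hℓ.ne hv (hs hi) (hs hk) (hs hi) (hs hj) (hij.trans hjk) hij (.inr hjk.ne'))))
    ((hP 1).imp (fun h i hi j hj k hk => h i (hI₂ hi) j (hI₂ hj) k (hI₂ hk))
      (fun h i hi j hj k hk hij hjk => lt_of_le_of_ne
        (not_lt.1 (h i (hI₂ hi) j (hI₂ hj) k (hI₂ hk) hij hjk))
        (hℓ.ne hv (hs hj) (hs hk) (hs hi) (hs hk) hjk (hij.trans hjk) (.inl hij.ne'))))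
    (hQ.imp id (fun h i hi j hj k hk l hl hij hjk hkl => lt_of_le_of_ne
        (not_lt.1 (h i hi j hj k hk l hl hij hjk hkl))
        (hℓ.ne hv (hs hj) (hs hk) (hs hi) (hs hl) hjk (hij.trans (hjk.trans hkl))
          (.inl hij.ne'))))
  obtain ⟨J, hJ, hJc⟩ := exists_subset_card_eq (show m ≤ #I₂ by omega)
  exact ⟨c, v, J, hJc, CanonOn.mono ⟨hv.mono hs, hlt⟩ hJ, fun i hi => hvS i (hs (hJ hi))⟩

/-! ### ⋆-canonical orders as comparison rules -/

theorem CanonicalType.LT.of_lt_of_lt {α : Type*} [LinearOrder α] (c : CanonicalType)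
    {i j k l : α} (h : i < k) (h' : j < l) : c.LT i j k l := by
  cases c <;> simp [CanonicalType.LT, h, h']

/-- The comparison of edges in the `⋆`-canonical order of type `(c, p)`. The pair `none, i` stands
for the edge at the special vertex, and `some i, j` with `i < j` for the edge between two other
vertices. -/
def SpecialType.LT {α : Type*} [LinearOrder α] (c : CanonicalType) :
    SpecialType → Option α → α → Option α → α → Prop
  | _, some i, j, some k, l => c.LT i j k l
  | .largerDecreasing, none, i, none, j => j < i
  | .smallerDecreasing, none, i, none, j => j < i
  | _, none, i, none, j => i < j
  | .largerIncreasing, none, _, some _, _ => False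
  | .largerDecreasing, none, _, some _, _ => False
  | .smallerIncreasing, none, _, some _, _ => True
  | .smallerDecreasing, none, _, some _, _ => True
  | .middleIncreasing, none, k, some i, j => c.LT k k i j
  | .largerIncreasing, some _, _, none, _ => True
  | .largerDecreasing, some _, _, none, _ => True
  | .smallerIncreasing, some _, _, none, _ => False
  | .smallerDecreasing, some _, _, none, _ => False
  | .middleIncreasing, some i, j, none, k => c.LT i j k k

theorem SpecialType.LT.map_iff {α β : Type*} [LinearOrder α] [LinearOrder β] {e : α → β}
    (he : StrictMono e) (c : CanonicalType) (p : SpecialType) (o : Option α) (j : α)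
    (o' : Option α) (k : α) :
    p.LT c (o.map e) (e j) (o'.map e) (e k) ↔ p.LT c o j o' k := by
  cases p <;> cases o <;> cases o' <;>
    simp [SpecialType.LT, he.lt_iff_lt, CanonicalType.LT.map_iff he]

/-- The hypotheses `h` and `h'` exclude degenerate pairs `some j, j`; otherwise such a pair would
tie with the edge at the special vertex in the middle type. -/
theorem SpecialType.LT.trichotomy {α : Type*} [LinearOrder α] (c : CanonicalType)
    (p : SpecialType) {o o' : Option α} {j k : α} (h : ∀ i ∈ o, i < j) (h' : ∀ i ∈ o', i < k) :
    p.LT c o j o' k ∨ (o = o' ∧ j = k) ∨ p.LT c o' k o j := by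
  rcases o with _ | i <;> rcases o' with _ | l
  · rcases lt_trichotomy j k with h | h | h <;> cases p <;> simp [SpecialType.LT, h]
  · have hne : ¬ (j = l ∧ j = k) := by rintro ⟨rfl, rfl⟩; simp at h'
    have := CanonicalType.LT.trichotomy c j j l k
    cases p <;> simp [SpecialType.LT]
    tauto
  · have hne : ¬ (i = k ∧ j = k) := by rintro ⟨rfl, rfl⟩; simp at h
    have := CanonicalType.LT.trichotomy c i j k k
    cases p <;> simp [SpecialType.LT]
    tauto
  · have := CanonicalType.LT.trichotomy c i j l k
    cases p <;> simpa [SpecialType.LT] using this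

/-- The vertices `w o`, where `o` is `none` or `some i` with `i ∈ J`, are ordered
`⋆`-canonically of type `(c, p)` with special vertex `w none`. -/
structure StarOn {α W : Type*} [LinearOrder α] (c : CanonicalType) (p : SpecialType)
    (ℓ : W → W → ℝ) (w : Option α → W) (J : Finset α) : Prop where
  injOn : Set.InjOn w (insertNone J)
  lt : ∀ o ∈ insertNone J, ∀ j ∈ J, ∀ o' ∈ insertNone J, ∀ k ∈ J, (∀ i ∈ o, i < j) →
    (∀ i ∈ o', i < k) → p.LT c o j o' k → ℓ (w o) (w (some j)) < ℓ (w o') (w (some k))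

theorem StarOn.mono {α W : Type*} [LinearOrder α] {c : CanonicalType} {p : SpecialType}
    {ℓ : W → W → ℝ} {w : Option α → W} {I J : Finset α} (h : StarOn c p ℓ w I) (hJ : J ⊆ I) :
    StarOn c p ℓ w J := by
  have hs : insertNone J ⊆ insertNone I := insertNone.monotone hJ
  exact ⟨h.injOn.mono (by exact_mod_cast hs), fun o ho j hj o' ho' k hk =>
    h.lt o (hs ho) j (hJ hj) o' (hs ho') k (hJ hk)⟩

/-- All types agree with the canonical order away from x, so only comparisons involving an edge at x
have to be checked. -/
theorem StarOn.of_canonOn {α W : Type*} [LinearOrder α] {c : CanonicalType} {p : SpecialType}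
    {ℓ : W → W → ℝ} {v : α → W} {x : W} {J : Finset α} (h : CanonOn c ℓ v J)
    (hx : ∀ i ∈ J, v i ≠ x)
    (h₁ : ∀ i ∈ J, ∀ j ∈ J, p.LT c none i none j → ℓ x (v i) < ℓ x (v j))
    (h₂ : ∀ k ∈ J, ∀ i ∈ J, ∀ j ∈ J, i < j → p.LT c none k (some i) j →
      ℓ x (v k) < ℓ (v i) (v j))
    (h₃ : ∀ k ∈ J, ∀ i ∈ J, ∀ j ∈ J, i < j → p.LT c (some i) j none k →
      ℓ (v i) (v j) < ℓ x (v k)) :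
    StarOn c p ℓ (fun o => o.elim x v) J := by
  constructor
  · intro a ha b hb hab
    rcases a with _ | a <;> rcases b with _ | b <;> simp at ha hb hab
    · rfl
    · exact absurd hab.symm (hx b hb)
    · exact absurd hab (hx a ha)
    · rw [h.injOn ha hb hab]
  · intro o ho j hj o' ho' k hk hoj hok hlt
    rcases o with _ | i <;> rcases o' with _ | l <;> simp at ho ho' hoj hok <;>
      simp only [Option.elim_none, Option.elim_some]
    · exact h₁ j hj k hk hlt
    · exact h₂ j hj l ho' k hk hok hlt
    · exact h₃ k hk i ho j hj hoj hlt
    · exact h.lt i ho j hj l ho' k hk hoj hok (by cases p <;> exact hlt)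

theorem image_elim_insertNone {α W : Type*} (x : W) (v : α → W) (J : Finset α) :
    (fun o : Option α => o.elim x v) '' insertNone J = insert x (v '' J) := by
  ext y
  simp [Option.exists, eq_comm]

/-- A canonical order is `⋆`-canonical for a suitable special vertex. -/
theorem CanonOn.exists_starOn {α W : Type*} [LinearOrder α] {c : CanonicalType}
    {ℓ : W → W → ℝ} (hℓ : ∀ a b, ℓ a b = ℓ b a) {v : α → W} {J : Finset α}
    (h : CanonOn c ℓ v J) (hJ : J.Nonempty) :
    ∃ a ∈ J, ∃ p, StarOn c p ℓ (fun o => o.elim (v a) v) (J.erase a) := by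
  have hs : ∀ {a i}, i ∈ J.erase a → i ∈ J := fun h => mem_of_mem_erase h
  have hv : ∀ a ∈ J, ∀ i ∈ J.erase a, v i ≠ v a := fun a ha i hi e =>
    ne_of_mem_erase hi (h.injOn (hs hi) ha e)
  have hmin : ∀ i ∈ J.erase (J.min' hJ), J.min' hJ < i := fun i hi =>
    lt_of_le_of_ne (J.min'_le i (hs hi)) (ne_of_mem_erase hi).symm
  have hmax : ∀ i ∈ J.erase (J.max' hJ), i < J.max' hJ := fun i hi =>
    lt_of_le_of_ne (J.le_max' i (hs hi)) (ne_of_mem_erase hi)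
  have ma := J.min'_mem hJ
  have mb := J.max'_mem hJ
  -- In the min types the edges at the first vertex precede all others; in the max types those at
  -- the last vertex follow all others. The tie-break rule makes them increasing, or decreasing for
  -- the inverse types.
  cases c
  · refine ⟨_, ma, .smallerIncreasing, .of_canonOn (h.mono (erase_subset _ _)) (hv _ ma)
      (fun i hi j hj hl => ?_) (fun k hk i hi j hj hij hl => ?_)
      (fun k hk i hi j hj hij hl => hl.elim)⟩
    · exact h.lt _ ma _ (hs hi) _ ma _ (hs hj) (hmin _ hi) (hmin _ hj) (.inr ⟨rfl, hl⟩)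
    · exact h.lt _ ma _ (hs hk) _ (hs hi) _ (hs hj) (hmin _ hk) hij (.inl (hmin _ hi))
  · refine ⟨_, mb, .largerIncreasing, .of_canonOn (h.mono (erase_subset _ _)) (hv _ mb)
      (fun i hi j hj hl => ?_) (fun k hk i hi j hj hij hl => hl.elim)
      (fun k hk i hi j hj hij hl => ?_)⟩
    · rw [hℓ _ (v i), hℓ _ (v j)]
      exact h.lt _ (hs hi) _ mb _ (hs hj) _ mb (hmax _ hi) (hmax _ hj) (.inr ⟨rfl, hl⟩)
    · rw [hℓ _ (v k)]
      exact h.lt _ (hs hi) _ (hs hj) _ (hs hk) _ mb hij (hmax _ hk) (.inl (hmax _ hj))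
  · refine ⟨_, ma, .smallerDecreasing, .of_canonOn (h.mono (erase_subset _ _)) (hv _ ma)
      (fun i hi j hj hl => ?_) (fun k hk i hi j hj hij hl => ?_)
      (fun k hk i hi j hj hij hl => hl.elim)⟩
    · exact h.lt _ ma _ (hs hi) _ ma _ (hs hj) (hmin _ hi) (hmin _ hj) (.inr ⟨rfl, hl⟩)
    · exact h.lt _ ma _ (hs hk) _ (hs hi) _ (hs hj) (hmin _ hk) hij (.inl (hmin _ hi))
  · refine ⟨_, mb, .largerDecreasing, .of_canonOn (h.mono (erase_subset _ _)) (hv _ mb)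
      (fun i hi j hj hl => ?_) (fun k hk i hi j hj hij hl => hl.elim)
      (fun k hk i hi j hj hij hl => ?_)⟩
    · rw [hℓ _ (v i), hℓ _ (v j)]
      exact h.lt _ (hs hi) _ mb _ (hs hj) _ mb (hmax _ hi) (hmax _ hj) (.inr ⟨rfl, hl⟩)
    · rw [hℓ _ (v k)]
      exact h.lt _ (hs hi) _ (hs hj) _ (hs hk) _ mb hij (hmax _ hk) (.inl (hmax _ hj))

/-! ### Adding a vertex to a canonical order -/

/-- With x placed last at index `M`, its edge to `v k` plays the role of the pair (k, M), so the
hypotheses compare exactly such pairs with each other and with the old ones. -/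
theorem CanonOn.insert_top {α W : Type*} [LinearOrder α] {c : CanonicalType}
    {ℓ : W → W → ℝ} (hℓ : ∀ a b, ℓ a b = ℓ b a) {v : α → W} {T : Finset α} {x : W} {M : α}
    (h : CanonOn c ℓ v T) (hx : ∀ i ∈ T, v i ≠ x) (hM : ∀ i ∈ T, i < M)
    (h₁ : ∀ i ∈ T, ∀ j ∈ T, c.LT i M j M → ℓ x (v i) < ℓ x (v j))
    (h₂ : ∀ k ∈ T, ∀ i ∈ T, ∀ j ∈ T, i < j → c.LT k M i j → ℓ x (v k) < ℓ (v i) (v j))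
    (h₃ : ∀ k ∈ T, ∀ i ∈ T, ∀ j ∈ T, i < j → c.LT i j k M → ℓ (v i) (v j) < ℓ x (v k)) :
    CanonOn c ℓ (Function.update v M x) (insert M T) := by
  have hu : ∀ i ∈ T, Function.update v M x i = v i := fun i hi =>
    Function.update_of_ne (hM i hi).ne _ _
  have hM' : Function.update v M x M = x := Function.update_self _ _ _
  constructor
  · intro i hi j hj hij
    rcases mem_insert.1 hi with rfl | hi' <;> rcases mem_insert.1 hj with rfl | hj'
    · rfl
    · rw [hM', hu j hj'] at hij; exact absurd hij.symm (hx j hj')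
    · rw [hM', hu i hi'] at hij; exact absurd hij (hx i hi')
    · rw [hu j hj', hu i hi'] at hij; exact h.injOn hi' hj' hij
  · intro i hi j hj k hk l hl hij hkl hlt
    have hi' : i ∈ T := (mem_insert.1 hi).resolve_left (by
      rintro rfl
      rcases mem_insert.1 hj with rfl | hj
      exacts [lt_irrefl _ hij, lt_asymm hij (hM j hj)])
    have hk' : k ∈ T := (mem_insert.1 hk).resolve_left (by
      rintro rfl
      rcases mem_insert.1 hl with rfl | hl
      exacts [lt_irrefl _ hkl, lt_asymm hkl (hM l hl)])
    rw [hu i hi', hu k hk']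
    rcases mem_insert.1 hj with rfl | hj' <;> rcases mem_insert.1 hl with rfl | hl'
    · rw [hM', hℓ (v i), hℓ (v k)]; exact h₁ i hi' k hk' hlt
    · rw [hM', hu l hl', hℓ (v i)]; exact h₂ i hi' k hk' l hl' hkl hlt
    · rw [hM', hu j hj', hℓ (v k)]; exact h₃ k hk' i hi' j hj' hij hlt
    · rw [hu j hj', hu l hl']; exact h.lt i hi' j hj' k hk' l hl' hij hkl hlt

theorem CanonOn.insert_bot {α W : Type*} [LinearOrder α] {c : CanonicalType}
    {ℓ : W → W → ℝ} {v : α → W} {T : Finset α} {x : W} {M : α}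
    (h : CanonOn c ℓ v T) (hx : ∀ i ∈ T, v i ≠ x) (hM : ∀ i ∈ T, M < i)
    (h₁ : ∀ i ∈ T, ∀ j ∈ T, c.LT M i M j → ℓ x (v i) < ℓ x (v j))
    (h₂ : ∀ k ∈ T, ∀ i ∈ T, ∀ j ∈ T, i < j → c.LT M k i j → ℓ x (v k) < ℓ (v i) (v j))
    (h₃ : ∀ k ∈ T, ∀ i ∈ T, ∀ j ∈ T, i < j → c.LT i j M k → ℓ (v i) (v j) < ℓ x (v k)) :
    CanonOn c ℓ (Function.update v M x) (insert M T) := by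
  have hu : ∀ i ∈ T, Function.update v M x i = v i := fun i hi =>
    Function.update_of_ne (hM i hi).ne' _ _
  have hM' : Function.update v M x M = x := Function.update_self _ _ _
  constructor
  · intro i hi j hj hij
    rcases mem_insert.1 hi with rfl | hi' <;> rcases mem_insert.1 hj with rfl | hj'
    · rfl
    · rw [hM', hu j hj'] at hij; exact absurd hij.symm (hx j hj')
    · rw [hM', hu i hi'] at hij; exact absurd hij (hx i hi')
    · rw [hu j hj', hu i hi'] at hij; exact h.injOn hi' hj' hij
  · intro i hi j hj k hk l hl hij hkl hlt
    have hj' : j ∈ T := (mem_insert.1 hj).resolve_left (by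
      rintro rfl
      rcases mem_insert.1 hi with rfl | hi
      exacts [lt_irrefl _ hij, lt_asymm hij (hM i hi)])
    have hl' : l ∈ T := (mem_insert.1 hl).resolve_left (by
      rintro rfl
      rcases mem_insert.1 hk with rfl | hk
      exacts [lt_irrefl _ hkl, lt_asymm hkl (hM k hk)])
    rw [hu j hj', hu l hl']
    rcases mem_insert.1 hi with rfl | hi' <;> rcases mem_insert.1 hk with rfl | hk'
    · rw [hM']; exact h₁ j hj' l hl' hlt
    · rw [hM', hu k hk']; exact h₂ j hj' k hk' l hl' hkl hlt
    · rw [hM', hu i hi']; exact h₃ l hl' i hi' j hj' hij hlt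
    · rw [hu i hi', hu k hk']; exact h.lt i hi' j hj' k hk' l hl' hij hkl hlt

/-- If the comparisons of the edges at `x` are homogeneous, then `x` is the special vertex of a
`⋆`-canonical order, or it can be added to the canonical order. -/
theorem CanonOn.starOn_or_insert_of_homogeneous {W : Type*} {c : CanonicalType}
    {ℓ : W → W → ℝ} (hℓ : ∀ a b, ℓ a b = ℓ b a) {v : ℤ → W} {T : Finset ℤ} {x : W}
    (h : CanonOn c ℓ v T) (hx : ∀ i ∈ T, v i ≠ x) (hT : 6 ≤ #T)
    (hs : (∀ i ∈ T, ∀ j ∈ T, i < j → ℓ x (v i) < ℓ x (v j)) ∨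
      ∀ i ∈ T, ∀ j ∈ T, i < j → ℓ x (v j) < ℓ x (v i))
    (hq₁ : (∀ i ∈ T, ∀ j ∈ T, i < j → ℓ x (v i) < ℓ (v i) (v j)) ∨
      ∀ i ∈ T, ∀ j ∈ T, i < j → ℓ (v i) (v j) < ℓ x (v i))
    (hq₂ : (∀ i ∈ T, ∀ j ∈ T, i < j → ℓ x (v j) < ℓ (v i) (v j)) ∨
      ∀ i ∈ T, ∀ j ∈ T, i < j → ℓ (v i) (v j) < ℓ x (v j))
    (hp₁ : (∀ i ∈ T, ∀ j ∈ T, ∀ k ∈ T, i < j → j < k → ℓ x (v i) < ℓ (v j) (v k)) ∨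
      ∀ i ∈ T, ∀ j ∈ T, ∀ k ∈ T, i < j → j < k → ℓ (v j) (v k) < ℓ x (v i))
    (hp₂ : (∀ i ∈ T, ∀ j ∈ T, ∀ k ∈ T, i < j → j < k → ℓ x (v j) < ℓ (v i) (v k)) ∨
      ∀ i ∈ T, ∀ j ∈ T, ∀ k ∈ T, i < j → j < k → ℓ (v i) (v k) < ℓ x (v j))
    (hp₃ : (∀ i ∈ T, ∀ j ∈ T, ∀ k ∈ T, i < j → j < k → ℓ x (v k) < ℓ (v i) (v j)) ∨
      ∀ i ∈ T, ∀ j ∈ T, ∀ k ∈ T, i < j → j < k → ℓ (v i) (v j) < ℓ x (v k)) :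
    (∃ p, StarOn c p ℓ (fun o => o.elim x v) T) ∨
      ∃ M ∉ T, CanonOn c ℓ (Function.update v M x) (insert M T) := by
  obtain ⟨e, he, hmem⟩ := exists_strictMono_fin_of_le_card hT
  have lt01 : e 0 < e 1 := he (by decide)
  have lt12 : e 1 < e 2 := he (by decide)
  have lt23 : e 2 < e 3 := he (by decide)
  have lt34 : e 3 < e 4 := he (by decide)
  have lt45 : e 4 < e 5 := he (by decide)
  have m0 := hmem 0
  have m1 := hmem 1
  have m2 := hmem 2
  have m3 := hmem 3
  have m4 := hmem 4
  have m5 := hmem 5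
  have hlt : ∀ i ∈ T, ∀ j ∈ T, ∀ k ∈ T, ∀ l ∈ T, i < j → k < l → i < k → j < l →
      ℓ (v i) (v j) < ℓ (v k) (v l) := fun i hi j hj k hk l hl hij hkl hik hjl =>
    h.lt i hi j hj k hk l hl hij hkl (.of_lt_of_lt c hik hjl)
  -- If the edges at x lie below earlier edges, then beyond `e 1` they lie below `v (e 0) v (e 1)`
  -- and so below every edge there. One instance refutes the opposite alternative in each other
  -- hypothesis, so all edges at x are smaller.
  rcases hp₃ with hp₃ | hp₃
  · have hsmall : ∀ k ∈ T, e 1 < k → ∀ i ∈ T, ∀ j ∈ T, e 1 < i → i < j →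
        ℓ x (v k) < ℓ (v i) (v j) := fun k hk h1k i hi j hj h1i hij =>
      (hp₃ _ m0 _ m1 k hk lt01 h1k).trans
        (hlt _ m0 _ m1 i hi j hj lt01 hij (lt01.trans h1i) (h1i.trans hij))
    replace hq₁ := hq₁.resolve_right fun hq =>
      lt_asymm (hq _ m2 _ m3 lt23) (hsmall _ m2 lt12 _ m2 _ m3 lt12 lt23)
    replace hq₂ := hq₂.resolve_right fun hq =>
      lt_asymm (hq _ m2 _ m3 lt23) (hsmall _ m3 (lt12.trans lt23) _ m2 _ m3 lt12 lt23)
    replace hp₁ := hp₁.resolve_right fun hq =>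
      lt_asymm (hq _ m2 _ m3 _ m4 lt23 lt34)
        (hsmall _ m2 lt12 _ m3 _ m4 (lt12.trans lt23) lt34)
    replace hp₂ := hp₂.resolve_right fun hq =>
      lt_asymm (hq _ m2 _ m3 _ m4 lt23 lt34)
        (hsmall _ m3 (lt12.trans lt23) _ m2 _ m4 lt12 (lt23.trans lt34))
    have hall : ∀ k ∈ T, ∀ i ∈ T, ∀ j ∈ T, i < j → ℓ x (v k) < ℓ (v i) (v j) := by
      intro k hk i hi j hj hij
      rcases lt_trichotomy k i with hki | rfl | hki
      · exact hp₁ k hk i hi j hj hki hij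
      · exact hq₁ k hk j hj hij
      rcases lt_trichotomy k j with hkj | rfl | hkj
      · exact hp₂ i hi k hk j hj hki hkj
      · exact hq₂ i hi k hk hij
      · exact hp₃ i hi j hj k hk hij hkj
    left
    rcases hs with hs | hs
    · exact ⟨.smallerIncreasing, .of_canonOn h hx hs (fun k hk i hi j hj hij _ =>
        hall k hk i hi j hj hij) fun _ _ _ _ _ _ _ hl => hl.elim⟩
    · exact ⟨.smallerDecreasing, .of_canonOn h hx (fun i hi j hj hij => hs j hj i hi hij)
        (fun k hk i hi j hj hij _ => hall k hk i hi j hj hij) fun _ _ _ _ _ _ _ hl => hl.elim⟩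
  -- Interleaved case: xv_k lies above edges that end before k and below edges that start after k.
  -- This forces the labels at x to increase.
  rcases hp₁ with hp₁ | hp₁
  · have hs : ∀ i ∈ T, ∀ j ∈ T, i < j → ℓ x (v i) < ℓ x (v j) := hs.resolve_right fun hs => by
      have h1 := hp₁ _ m0 _ m1 _ m2 lt01 lt12
      have h2 := hp₃ _ m1 _ m2 _ m3 lt12 lt23
      have h3 := hs _ m0 _ m3 (lt01.trans (lt12.trans lt23))
      linarith
    -- A long edge lies below an edge nested inside it, which lies below later edges at x. This
    -- settles `hq₂` and `hp₂`, so only the left end matters; `hmaxType` is the mirror image.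
    have hminType : (c = .min ∨ c = .invMin) → ∀ k ∈ T, ∀ i ∈ T, ∀ j ∈ T, i < j → i < k →
        ℓ (v i) (v j) < ℓ x (v k) := by
      intro hc
      have hnest : ∀ i ∈ T, ∀ j ∈ T, ∀ k ∈ T, ∀ l ∈ T, i < j → k < l → i < k →
          ℓ (v i) (v j) < ℓ (v k) (v l) := fun i hi j hj k hk l hl hij hkl hik =>
        h.lt i hi j hj k hk l hl hij hkl (by rcases hc with rfl | rfl <;> exact .inl hik)
      replace hq₂ := hq₂.resolve_left fun hq => by
        have h1 := hq _ m0 _ m3 (lt01.trans (lt12.trans lt23))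
        have h2 := hnest _ m0 _ m3 _ m1 _ m2 (lt01.trans (lt12.trans lt23)) lt12 lt01
        have h3 := hp₃ _ m1 _ m2 _ m3 lt12 lt23
        linarith
      replace hp₂ := hp₂.resolve_left fun hq => by
        have h1 := hq _ m0 _ m3 _ m4 (lt01.trans (lt12.trans lt23)) lt34
        have h2 := hnest _ m0 _ m4 _ m1 _ m2 (lt01.trans (lt12.trans (lt23.trans lt34))) lt12 lt01
        have h3 := hp₃ _ m1 _ m2 _ m3 lt12 lt23
        linarith
      intro k hk i hi j hj hij hik
      rcases lt_trichotomy k j with hkj | rfl | hkj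
      · exact hp₂ i hi k hk j hj hik hkj
      · exact hq₂ i hi k hk hij
      · exact hp₃ i hi j hj k hk hij hkj
    have hmaxType : (c = .max ∨ c = .invMax) → ∀ k ∈ T, ∀ i ∈ T, ∀ j ∈ T, i < j → k < j →
        ℓ x (v k) < ℓ (v i) (v j) := by
      intro hc
      have hnest : ∀ i ∈ T, ∀ j ∈ T, ∀ k ∈ T, ∀ l ∈ T, i < j → k < l → j < l →
          ℓ (v i) (v j) < ℓ (v k) (v l) := fun i hi j hj k hk l hl hij hkl hik =>
        h.lt i hi j hj k hk l hl hij hkl (by rcases hc with rfl | rfl <;> exact .inl hik)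
      replace hq₁ := hq₁.resolve_right fun hq => by
        have h1 := hq _ m0 _ m3 (lt01.trans (lt12.trans lt23))
        have h2 := hnest _ m1 _ m2 _ m0 _ m3 lt12 (lt01.trans (lt12.trans lt23)) lt23
        have h3 := hp₁ _ m0 _ m1 _ m2 lt01 lt12
        linarith
      replace hp₂ := hp₂.resolve_right fun hq => by
        have h1 := hq _ m0 _ m1 _ m4 lt01 (lt12.trans (lt23.trans lt34))
        have h2 := hnest _ m2 _ m3 _ m0 _ m4 lt23 (lt01.trans (lt12.trans (lt23.trans lt34))) lt34
        have h3 := hp₁ _ m1 _ m2 _ m3 lt12 lt23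
        linarith
      intro k hk i hi j hj hij hkj
      rcases lt_trichotomy k i with hki | rfl | hki
      · exact hp₁ k hk i hi j hj hki hij
      · exact hq₁ k hk j hj hij
      · exact hp₂ i hi k hk j hj hki hkj
    have hne : T.Nonempty := ⟨_, m0⟩
    have hA : ∀ i ∈ T, T.min' hne - 1 < i := fun i hi => by
      have := T.min'_le i hi; omega
    have hB : ∀ i ∈ T, i < T.max' hne + 1 := fun i hi => by
      have := T.le_max' i hi; omega
    have hA' : T.min' hne - 1 ∉ T := fun h => lt_irrefl _ (hA _ h)
    have hB' : T.max' hne + 1 ∉ T := fun h => lt_irrefl _ (hB _ h)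
    -- Open is only whether xv_k comes before or after the edges whose dominant end is k. One answer
    -- agrees with the degenerate pair (k, k), giving the middle type. The other agrees with a new
    -- last index in the min types, or a new first index in the max types.
    cases c
    · replace hminType := hminType (.inl rfl)
      rcases hq₁ with hq | hq
      · refine .inl ⟨.middleIncreasing, .of_canonOn h hx hs ?_ ?_⟩
        · rintro k hk i hi j hj hij (hl | ⟨rfl, hl⟩)
          exacts [hp₁ k hk i hi j hj hl hij, hq k hk j hj hij]
        · rintro k hk i hi j hj hij (hl | ⟨rfl, hl⟩)
          exacts [hminType k hk i hi j hj hij hl, absurd hl hij.not_gt]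
      · refine .inr ⟨_, hB', h.insert_top hℓ hx hB ?_ ?_ ?_⟩
        · rintro i hi j hj (hl | ⟨-, hl⟩)
          exacts [hs i hi j hj hl, absurd hl (lt_irrefl _)]
        · rintro k hk i hi j hj hij (hl | ⟨-, hl⟩)
          exacts [hp₁ k hk i hi j hj hl hij, absurd hl (hB j hj).not_gt]
        · rintro k hk i hi j hj hij (hl | ⟨rfl, -⟩)
          exacts [hminType k hk i hi j hj hij hl, hq i hi j hj hij]
    · replace hmaxType := hmaxType (.inl rfl)
      rcases hq₂ with hq | hq
      · refine .inr ⟨_, hA', h.insert_bot hx hA ?_ ?_ ?_⟩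
        · rintro i hi j hj (hl | ⟨-, hl⟩)
          exacts [hs i hi j hj hl, absurd hl (lt_irrefl _)]
        · rintro k hk i hi j hj hij (hl | ⟨rfl, -⟩)
          exacts [hmaxType k hk i hi j hj hij hl, hq i hi k hk hij]
        · rintro k hk i hi j hj hij (hl | ⟨-, hl⟩)
          exacts [hp₃ i hi j hj k hk hij hl, absurd hl (hA i hi).not_gt]
      · refine .inl ⟨.middleIncreasing, .of_canonOn h hx hs ?_ ?_⟩
        · rintro k hk i hi j hj hij (hl | ⟨rfl, hl⟩)
          exacts [hmaxType k hk i hi j hj hij hl, absurd hl hij.not_gt]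
        · rintro k hk i hi j hj hij (hl | ⟨rfl, -⟩)
          exacts [hp₃ i hi j hj k hk hij hl, hq i hi j hj hij]
    · replace hminType := hminType (.inr rfl)
      rcases hq₁ with hq | hq
      · refine .inr ⟨_, hB', h.insert_top hℓ hx hB ?_ ?_ ?_⟩
        · rintro i hi j hj (hl | ⟨-, hl⟩)
          exacts [hs i hi j hj hl, absurd hl (lt_irrefl _)]
        · rintro k hk i hi j hj hij (hl | ⟨rfl, -⟩)
          exacts [hp₁ k hk i hi j hj hl hij, hq k hk j hj hij]
        · rintro k hk i hi j hj hij (hl | ⟨-, hl⟩)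
          exacts [hminType k hk i hi j hj hij hl, absurd hl (hB j hj).not_gt]
      · refine .inl ⟨.middleIncreasing, .of_canonOn h hx hs ?_ ?_⟩
        · rintro k hk i hi j hj hij (hl | ⟨rfl, hl⟩)
          exacts [hp₁ k hk i hi j hj hl hij, absurd hl hij.not_gt]
        · rintro k hk i hi j hj hij (hl | ⟨rfl, -⟩)
          exacts [hminType k hk i hi j hj hij hl, hq i hi j hj hij]
    · replace hmaxType := hmaxType (.inr rfl)
      rcases hq₂ with hq | hq
      · refine .inl ⟨.middleIncreasing, .of_canonOn h hx hs ?_ ?_⟩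
        · rintro k hk i hi j hj hij (hl | ⟨rfl, -⟩)
          exacts [hmaxType k hk i hi j hj hij hl, hq i hi k hk hij]
        · rintro k hk i hi j hj hij (hl | ⟨rfl, hl⟩)
          exacts [hp₃ i hi j hj k hk hij hl, absurd hl hij.not_gt]
      · refine .inr ⟨_, hA', h.insert_bot hx hA ?_ ?_ ?_⟩
        · rintro i hi j hj (hl | ⟨-, hl⟩)
          exacts [hs i hi j hj hl, absurd hl (lt_irrefl _)]
        · rintro k hk i hi j hj hij (hl | ⟨-, hl⟩)
          exacts [hmaxType k hk i hi j hj hij hl, absurd hl (hA i hi).not_gt]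
        · rintro k hk i hi j hj hij (hl | ⟨rfl, -⟩)
          exacts [hp₃ i hi j hj k hk hij hl, hq i hi j hj hij]
  -- Mirror image of the first case: edges at x lie above the late edge `v (e 4) v (e 5)`, which
  -- lies above the early ones.
  · have hlarge : ∀ k ∈ T, k < e 4 → ∀ i ∈ T, ∀ j ∈ T, i < e 4 → j < e 5 → i < j →
        ℓ (v i) (v j) < ℓ x (v k) := fun k hk hk4 i hi j hj hi4 hj5 hij =>
      (hlt i hi j hj _ m4 _ m5 hij lt45 hi4 hj5).trans (hp₁ k hk _ m4 _ m5 hk4 lt45)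
    have lt24 := lt23.trans lt34
    have lt14 := lt12.trans lt24
    have lt04 := lt01.trans lt14
    replace hq₁ := hq₁.resolve_left fun hq =>
      lt_asymm (hq _ m0 _ m1 lt01) (hlarge _ m0 lt04 _ m0 _ m1 lt04 (lt14.trans lt45) lt01)
    replace hq₂ := hq₂.resolve_left fun hq =>
      lt_asymm (hq _ m0 _ m1 lt01) (hlarge _ m1 lt14 _ m0 _ m1 lt04 (lt14.trans lt45) lt01)
    replace hp₂ := hp₂.resolve_left fun hq =>
      lt_asymm (hq _ m0 _ m1 _ m2 lt01 lt12)
        (hlarge _ m1 lt14 _ m0 _ m2 lt04 (lt24.trans lt45) (lt01.trans lt12))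
    have hall : ∀ k ∈ T, ∀ i ∈ T, ∀ j ∈ T, i < j → ℓ (v i) (v j) < ℓ x (v k) := by
      intro k hk i hi j hj hij
      rcases lt_trichotomy k i with hki | rfl | hki
      · exact hp₁ k hk i hi j hj hki hij
      · exact hq₁ k hk j hj hij
      rcases lt_trichotomy k j with hkj | rfl | hkj
      · exact hp₂ i hi k hk j hj hki hkj
      · exact hq₂ i hi k hk hij
      · exact hp₃ i hi j hj k hk hij hkj
    left
    rcases hs with hs | hs
    · exact ⟨.largerIncreasing, .of_canonOn h hx hs (fun _ _ _ _ _ _ _ hl => hl.elim)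
        fun k hk i hi j hj hij _ => hall k hk i hi j hj hij⟩
    · exact ⟨.largerDecreasing, .of_canonOn h hx (fun i hi j hj hij => hs j hj i hi hij)
        (fun _ _ _ _ _ _ _ hl => hl.elim) fun k hk i hi j hj hij _ => hall k hk i hi j hj hij⟩

/-- In every large canonical order, every further vertex `x` lies in a `⋆`-canonical order whose
other vertices belong to the canonical order. -/
theorem exists_starOn (n : ℕ) : ∃ N, ∀ {W : Type} {c : CanonicalType} {ℓ : W → W → ℝ},
    IsLabeling ℓ → ∀ {v : ℤ → W} {I : Finset ℤ} {x : W}, CanonOn c ℓ v I →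
    (∀ i ∈ I, v i ≠ x) → N ≤ #I → ∃ J ⊆ I, #J = n ∧ ∃ (p : SpecialType) (w : Option ℤ → W)
      (J' : Finset ℤ), #J' = n ∧ StarOn c p ℓ w J' ∧
        w '' insertNone J' = insert x (v '' J) := by
  obtain ⟨N₃, h₃⟩ := exists_homogeneous_triples (α := ℤ) 3 (n + 6)
  obtain ⟨N₂, h₂⟩ := exists_homogeneous_pairs (α := ℤ) 3 N₃
  refine ⟨N₂, fun {W c ℓ} hℓ {v I x} h hx hN => ?_⟩
  obtain ⟨I₁, hI₁, hI₁c, hP⟩ := h₂ ![fun i j => ℓ x (v i) < ℓ x (v j),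
    fun i j => ℓ x (v i) < ℓ (v i) (v j), fun i j => ℓ x (v j) < ℓ (v i) (v j)] I hN
  obtain ⟨T, hT, hTc, hQ⟩ := h₃ ![fun i j k => ℓ x (v i) < ℓ (v j) (v k),
    fun i j k => ℓ x (v j) < ℓ (v i) (v k), fun i j k => ℓ x (v k) < ℓ (v i) (v j)] I₁ hI₁c.ge
  have hTI := hT.trans hI₁
  have hTx : ∀ i ∈ T, v i ≠ x := fun i hi => hx i (hTI hi)
  have hc := h.mono hTI
  have hne : ∀ k ∈ T, ∀ i ∈ T, ∀ j ∈ T, i < j → ¬ ℓ x (v k) < ℓ (v i) (v j) →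
      ℓ (v i) (v j) < ℓ x (v k) := by
    intro k hk i hi j hj hij hlt
    refine lt_of_le_of_ne (not_lt.1 hlt) fun e => ?_
    have := hℓ.inj _ _ _ _ (fun e => hij.ne (hc.injOn hi hj e)) (hTx k hk).symm e
    rcases Sym2.eq_iff.1 this with ⟨h1, -⟩ | ⟨-, h1⟩
    exacts [hTx i hi h1, hTx j hj h1]
  have hne' : ∀ i ∈ T, ∀ j ∈ T, i < j → ¬ ℓ x (v i) < ℓ x (v j) → ℓ x (v j) < ℓ x (v i) := by
    intro i hi j hj hij hlt
    refine lt_of_le_of_ne (not_lt.1 hlt) fun e => ?_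
    have := hℓ.inj _ _ _ _ (hTx j hj).symm (hTx i hi).symm e
    exact hij.ne' (hc.injOn hj hi (Sym2.congr_right.1 this))
  have key := hc.starOn_or_insert_of_homogeneous hℓ.symm hTx (by omega)
    ((hP 0).imp (fun h i hi j hj => h i (hT hi) j (hT hj))
      fun h i hi j hj hij => hne' i hi j hj hij (h i (hT hi) j (hT hj) hij))
    ((hP 1).imp (fun h i hi j hj => h i (hT hi) j (hT hj))
      fun h i hi j hj hij => hne i hi i hi j hj hij (h i (hT hi) j (hT hj) hij))
    ((hP 2).imp (fun h i hi j hj => h i (hT hi) j (hT hj))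
      fun h i hi j hj hij => hne j hj i hi j hj hij (h i (hT hi) j (hT hj) hij))
    ((hQ 0).imp id fun h i hi j hj k hk hij hjk =>
      hne i hi j hj k hk hjk (h i hi j hj k hk hij hjk))
    ((hQ 1).imp id fun h i hi j hj k hk hij hjk =>
      hne j hj i hi k hk (hij.trans hjk) (h i hi j hj k hk hij hjk))
    ((hQ 2).imp id fun h i hi j hj k hk hij hjk =>
      hne k hk i hi j hj hij (h i hi j hj k hk hij hjk))
  obtain ⟨J, hJ, hJc⟩ := exists_subset_card_eq (show n ≤ #T by omega)
  refine ⟨J, hJ.trans hTI, hJc, ?_⟩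
  rcases key with ⟨p, hp⟩ | ⟨M, hM, hMc⟩
  · exact ⟨p, _, J, hJc, hp.mono hJ, image_elim_insertNone x v J⟩
  · have hMJ : M ∉ J := fun h => hM (hJ h)
    -- Here x is an ordinary vertex of a canonical order on n + 1 vertices, and the special vertex
    -- is one of its ends, possibly different from x. Only the vertex set matters for tiling, so the
    -- conclusion fixes just the image of `w`.
    obtain ⟨a, ha, p, hp⟩ := (hMc.mono (insert_subset_insert M hJ)).exists_starOn hℓ.symm
      (insert_nonempty _ _)
    refine ⟨p, _, _, by rw [card_erase_of_mem ha, card_insert_of_notMem hMJ, hJc]; rfl, hp, ?_⟩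
    have hu : ∀ i ∈ J, Function.update v M x i = v i := fun i hi =>
      Function.update_of_ne (fun e : i = M => hMJ (e ▸ hi)) _ _
    have h1 : (fun o : Option ℤ => o.elim (Function.update v M x a) (Function.update v M x)) ''
        insertNone ((insert M J).erase a) = Function.update v M x '' (insert M J : Finset ℤ) := by
      rw [image_elim_insertNone, ← Set.image_insert_eq, ← coe_insert, insert_erase ha]
    rw [h1, coe_insert, Set.image_insert_eq, Function.update_self]
    congr 1
    exact Set.image_congr fun i hi => hu i hi

/-! ### The standard labelings realize the comparison rules -/

/-- The dominant index has coefficient at least 2n − 1, which outweighs any change of the other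
index, as both lie between 1 and n. -/
theorem CanonicalType.label_lt_label (c : CanonicalType) {n i j k l : ℕ} (hi : 1 ≤ i)
    (hij : i < j) (hj : j ≤ n) (hk : 1 ≤ k) (hkl : k < l) (hl : l ≤ n) (h : c.LT i j k l) :
    c.label n i j < c.label n k l := by
  have hi' : (1 : ℝ) ≤ i := by exact_mod_cast hi
  have hij' : (i : ℝ) + 1 ≤ j := by exact_mod_cast hij
  have hj' : (j : ℝ) ≤ n := by exact_mod_cast hj
  have hk' : (1 : ℝ) ≤ k := by exact_mod_cast hk
  have hkl' : (k : ℝ) + 1 ≤ l := by exact_mod_cast hkl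
  have hl' : (l : ℝ) ≤ n := by exact_mod_cast hl
  have hn : (0 : ℝ) ≤ n := n.cast_nonneg
  cases c <;> rcases h with h | ⟨rfl, h⟩ <;>
    replace h := (Nat.cast_le (α := ℝ)).2 (Nat.succ_le_of_lt h) <;> push_cast at h <;>
    simp only [CanonicalType.label]
  · nlinarith [mul_le_mul_of_nonneg_left h hn]
  · linarith
  · nlinarith [mul_le_mul_of_nonneg_left h hn]
  · linarith
  · nlinarith [mul_le_mul_of_nonneg_left h hn]
  · linarith
  · nlinarith [mul_le_mul_of_nonneg_left h hn]
  · linarith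

/-- Together with `CanonicalType.label_lt`, this shows that the middle label 2nk sits among the
labels where the degenerate pair (k, k) sits among the pairs. -/
theorem CanonicalType.lt_label (c : CanonicalType) {n i j k : ℕ} (hi : 1 ≤ i)
    (hij : i < j) (hj : j ≤ n) (h : c.LT k k i j) : 2 * (n : ℝ) * k < c.label n i j := by
  have hi' : (1 : ℝ) ≤ i := by exact_mod_cast hi
  have hij' : (i : ℝ) + 1 ≤ j := by exact_mod_cast hij
  have hj' : (j : ℝ) ≤ n := by exact_mod_cast hj
  have hn : (0 : ℝ) ≤ n := n.cast_nonneg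
  cases c <;> rcases h with h | ⟨rfl, h⟩ <;>
    replace h := (Nat.cast_le (α := ℝ)).2 (Nat.succ_le_of_lt h) <;> push_cast at h <;>
    simp only [CanonicalType.label] <;> nlinarith [mul_le_mul_of_nonneg_left h hn]

theorem CanonicalType.label_lt (c : CanonicalType) {n i j k : ℕ} (hi : 1 ≤ i)
    (hij : i < j) (hj : j ≤ n) (h : c.LT i j k k) : c.label n i j < 2 * (n : ℝ) * k := by
  have hi' : (1 : ℝ) ≤ i := by exact_mod_cast hi
  have hij' : (i : ℝ) + 1 ≤ j := by exact_mod_cast hij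
  have hj' : (j : ℝ) ≤ n := by exact_mod_cast hj
  have hn : (0 : ℝ) ≤ n := n.cast_nonneg
  cases c <;> rcases h with h | ⟨rfl, h⟩ <;>
    replace h := (Nat.cast_le (α := ℝ)).2 (Nat.succ_le_of_lt h) <;> push_cast at h <;>
    simp only [CanonicalType.label] <;> nlinarith [mul_le_mul_of_nonneg_left h hn]

/-- The bounds leave room for the larger and smaller special types: labels above 2n² + n, or below
0. -/
theorem CanonicalType.label_mem_Icc (c : CanonicalType) {n i j : ℕ} (hi : 1 ≤ i)
    (hij : i < j) (hj : j ≤ n) : c.label n i j ∈ Set.Icc (0 : ℝ) (2 * n * n + n) := by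
  have hi' : (1 : ℝ) ≤ i := by exact_mod_cast hi
  have hij' : (i : ℝ) + 1 ≤ j := by exact_mod_cast hij
  have hj' : (j : ℝ) ≤ n := by exact_mod_cast hj
  have hn : (0 : ℝ) ≤ n := n.cast_nonneg
  have h₁ : (i : ℝ) ≤ n := by linarith
  have h₂ : (1 : ℝ) ≤ j := by linarith
  cases c <;> simp only [CanonicalType.label, Set.mem_Icc] <;> constructor <;>
    nlinarith [mul_le_mul_of_nonneg_left hi' hn, mul_le_mul_of_nonneg_left hj' hn,
      mul_le_mul_of_nonneg_left h₁ hn, mul_le_mul_of_nonneg_left h₂ hn]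

/-- The label of the edge `ab` of a complete graph as a function of its ends. -/
noncomputable def edgeLabel {W : Type*} (L : (⊤ : SimpleGraph W).edgeSet → ℝ) (a b : W) : ℝ :=
  open Classical in if h : a ≠ b then L ⟨s(a, b), by simpa using h⟩ else 0

theorem edgeLabel_of_ne {W : Type*} (L : (⊤ : SimpleGraph W).edgeSet → ℝ) {a b : W}
    (h : a ≠ b) : edgeLabel L a b = L ⟨s(a, b), by simpa using h⟩ := dif_pos h

theorem edgeLabel_symm {W : Type*} (L : (⊤ : SimpleGraph W).edgeSet → ℝ) (a b : W) :
    edgeLabel L a b = edgeLabel L b a := by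
  by_cases h : a = b
  · rw [h]
  · rw [edgeLabel_of_ne L h, edgeLabel_of_ne L (Ne.symm h)]
    congr 2
    exact Sym2.eq_swap

theorem isLabeling_edgeLabel {W : Type*} {L : (⊤ : SimpleGraph W).edgeSet → ℝ}
    (hL : Function.Injective L) : IsLabeling (edgeLabel L) where
  symm := edgeLabel_symm L
  inj a b c d hab hcd h := by
    rw [edgeLabel_of_ne L hab, edgeLabel_of_ne L hcd] at h
    exact congrArg Subtype.val (hL h)

/-- Labels depend on n and do not restrict to subsets, whereas comparisons do; this passes from the
former to the latter. -/
theorem IsStarCanonical.starOn {n : ℕ} {c : CanonicalType} {p : SpecialType}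
    {L : (starGraph n).edgeSet → ℝ} (h : IsStarCanonical c p L) :
    StarOn c p (edgeLabel L) id univ := by
  refine ⟨Function.injective_id.injOn, fun o _ j _ o' _ k _ hoj hok hlt => ?_⟩
  obtain ⟨hA, hX⟩ := h
  have hv : ∀ i j : Fin n, i < j → edgeLabel L (some i) (some j) = c.label n (i + 1) (j + 1) :=
    fun i j hij => (edgeLabel_of_ne L (by simpa using hij.ne)).trans (hA i j hij)
  have hx : ∀ i : Fin n, edgeLabel L none (some i) = L ⟨s(none, some i), by simp⟩ := fun i =>
    edgeLabel_of_ne L (by simp)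
  have hlab : ∀ i j k l : Fin n, c.LT i j k l →
      c.LT ((i : ℕ) + 1) ((j : ℕ) + 1) ((k : ℕ) + 1) ((l : ℕ) + 1) := fun i j k l =>
    (CanonicalType.LT.map_iff (e := fun i : Fin n => (i : ℕ) + 1)
      (fun _ _ h => Nat.succ_lt_succ h) c i j k l).2
  simp only [id]
  rcases o with _ | i <;> rcases o' with _ | l <;> simp only [Option.mem_def, Option.some.injEq,
    forall_eq', reduceCtorEq, IsEmpty.forall_iff, implies_true] at hoj hok
  · rw [hx, hx]
    cases p <;> simp only [SpecialType.LT] at hlt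
    · exact hX.1 hlt
    · exact hX.1 hlt
    · exact hX.1 hlt
    · exact hX.1 hlt
    · have h1 := hX j
      have h2 := hX k
      simp only at h1 h2
      rw [h1, h2]
      have hn : (0 : ℝ) < n := by exact_mod_cast j.pos
      have : ((j : ℕ) : ℝ) < (k : ℕ) := by exact_mod_cast hlt
      gcongr
  · rw [hx, hv l k hok]
    cases p <;> simp only [SpecialType.LT] at hlt
    · exact hX.2 j l k hok
    · exact hX.2 j l k hok
    · have h1 := hX j
      simp only at h1
      rw [h1]
      have := c.lt_label (n := n) (Nat.succ_pos l) (Nat.succ_lt_succ hok) k.isLt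
        (hlab j j l k hlt)
      exact_mod_cast this
  · rw [hx, hv i j hoj]
    cases p <;> simp only [SpecialType.LT] at hlt
    · exact hX.2 k i j hoj
    · exact hX.2 k i j hoj
    · have h1 := hX k
      simp only at h1
      rw [h1]
      have := c.label_lt (n := n) (Nat.succ_pos i) (Nat.succ_lt_succ hoj) j.isLt
        (hlab i j k k hlt)
      exact_mod_cast this
  · rw [hv i j hoj, hv l k hok]
    have hlt : c.LT i j l k := by cases p <;> exact hlt
    exact c.label_lt_label (Nat.succ_pos i) (Nat.succ_lt_succ hoj) j.isLt (Nat.succ_pos l)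
      (Nat.succ_lt_succ hok) k.isLt (hlab i j l k hlt)

theorem StarOn.exists_fin {α W : Type*} [LinearOrder α] {c : CanonicalType} {p : SpecialType}
    {ℓ : W → W → ℝ} {w : Option α → W} {J : Finset α} (h : StarOn c p ℓ w J) {n : ℕ}
    (hJ : #J = n) : ∃ u : Option (Fin n) → W, StarOn c p ℓ u univ ∧
      Set.range u = w '' insertNone J := by
  let e := J.orderEmbOfFin hJ
  have hm : ∀ o : Option (Fin n), o.map e ∈ insertNone J := by
    rintro (_ | i) <;> simp [e]
  have hv : ∀ {o : Option (Fin n)} {j : Fin n}, (∀ i ∈ o, i < j) → ∀ i ∈ o.map e, i < e j := by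
    rintro (_ | i) j hij <;> simp at hij ⊢
    exact hij
  refine ⟨fun o => w (o.map e), ⟨fun a _ b _ hab => Option.map_injective e.injective
    (h.injOn (hm a) (hm b) hab), fun o _ j _ o' _ k _ hoj hok hl => ?_⟩, ?_⟩
  · exact h.lt _ (hm o) _ (J.orderEmbOfFin_mem hJ j) _ (hm o') _ (J.orderEmbOfFin_mem hJ k)
      (hv hoj) (hv hok) ((SpecialType.LT.map_iff e.strictMono c p o j o' k).2 hl)
  · ext y
    constructor
    · rintro ⟨o, rfl⟩
      exact ⟨_, hm o, rfl⟩
    · rintro ⟨_ | i, hi, rfl⟩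
      · exact ⟨none, rfl⟩
      · obtain ⟨k, rfl⟩ : i ∈ Set.range e := by
          rw [range_orderEmbOfFin]
          simpa using hi
        exact ⟨some k, rfl⟩

theorem Option.exists_oriented {α : Type*} [LinearOrder α] {a b : Option α} (h : a ≠ b) :
    ∃ o j, (∀ i ∈ o, i < j) ∧ s(a, b) = s(o, some j) := by
  rcases a with _ | i <;> rcases b with _ | j
  · exact absurd rfl h
  · exact ⟨none, j, by simp, rfl⟩
  · exact ⟨none, i, by simp, Sym2.eq_swap⟩
  · rcases lt_trichotomy i j with hij | rfl | hij
    · exact ⟨some i, j, by simpa using hij, rfl⟩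
    · exact absurd rfl h
    · exact ⟨some j, i, by simpa using hij, Sym2.eq_swap⟩

theorem IsStarCanonical.injective {n : ℕ} {c : CanonicalType} {p : SpecialType}
    {L : (starGraph n).edgeSet → ℝ} (h : IsStarCanonical c p L) : Function.Injective L := by
  rintro ⟨e, he⟩ ⟨e', he'⟩ hL
  induction e with | _ a b
  induction e' with | _ a' b'
  obtain ⟨o, j, hoj, ho⟩ := Option.exists_oriented (show a ≠ b by simpa using he)
  obtain ⟨o', k, hok, ho'⟩ := Option.exists_oriented (show a' ≠ b' by simpa using he')
  simp only [ho, ho', Subtype.mk.injEq] at hL ⊢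
  have hne : ∀ {o : Option (Fin n)} {j : Fin n}, (∀ i ∈ o, i < j) → o ≠ some j := by
    rintro o j h rfl
    exact lt_irrefl j (h j rfl)
  have hs := h.starOn.lt
  have e1 : edgeLabel L o (some j) = edgeLabel L o' (some k) := by
    rw [edgeLabel_of_ne L (hne hoj), edgeLabel_of_ne L (hne hok)]
    exact hL
  have hm : ∀ o : Option (Fin n), o ∈ insertNone univ := by simp
  rcases SpecialType.LT.trichotomy c p hoj hok with h | ⟨rfl, rfl⟩ | h
  · exact absurd e1 (hs o (hm _) j (mem_univ _) o' (hm _) k (mem_univ _) hoj hok h).ne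
  · rfl
  · exact absurd e1 (hs o' (hm _) k (mem_univ _) o (hm _) j (mem_univ _) hok hoj h).ne'

/-- Both directions need an actual labeling: one to order K_t, the other to supply a copy of F that
can be transferred. -/
theorem exists_isStarCanonical (n : ℕ) (c : CanonicalType) (p : SpecialType) :
    ∃ L : (starGraph n).edgeSet → ℝ, IsStarCanonical c p L := by
  suffices h : ∃ X : Fin n → ℝ, p.Holds X fun i j => c.label n (i + 1) (j + 1) by
    obtain ⟨X, hX⟩ := h
    let f : Option (Fin n) → Option (Fin n) → ℝ := fun a b => match a, b with
      | none, none => 0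
      | none, some i => X i
      | some i, none => X i
      | some i, some j => c.label n ((min i j : Fin n) + 1) ((max i j : Fin n) + 1)
    have hf : ∀ a b, f a b = f b a := by
      rintro (_ | i) (_ | j) <;> simp only [f]
      rw [min_comm, max_comm]
    refine ⟨fun e => Sym2.lift ⟨f, hf⟩ e.1, fun i j hij => ?_, ?_⟩
    · simp only [Sym2.lift_mk, f, min_eq_left hij.le, max_eq_right hij.le]
    · simpa [f] using hX
  have hb : ∀ i j : Fin n, i < j →
      c.label n (i + 1) (j + 1) ∈ Set.Icc (0 : ℝ) (2 * n * n + n) := fun i j hij =>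
    c.label_mem_Icc (Nat.succ_pos i) (Nat.succ_lt_succ hij) j.isLt
  have hn : ∀ i : Fin n, ((i : ℕ) : ℝ) < n := fun i => by exact_mod_cast i.isLt
  have hc : ∀ i j : Fin n, i < j → ((i : ℕ) : ℝ) < (j : ℕ) := fun i j h => by exact_mod_cast h
  have h0 : ∀ i : Fin n, (0 : ℝ) ≤ ((i : ℕ) : ℝ) := fun i => Nat.cast_nonneg _
  cases p
  · refine ⟨fun i => 2 * n * n + n + 1 + (i : ℕ), fun i j hij => ?_, fun k i j hij => ?_⟩
    · have := hc i j hij; simp only; linarith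
    · have := (hb i j hij).2; have := h0 k; simp only; linarith
  · refine ⟨fun i => 2 * n * n + n + n - (i : ℕ), fun i j hij => ?_, fun k i j hij => ?_⟩
    · have := hc i j hij; simp only; linarith
    · have := (hb i j hij).2; have := hn k; simp only; linarith
  · refine ⟨fun i => (i : ℕ) - n, fun i j hij => ?_, fun k i j hij => ?_⟩
    · have := hc i j hij; simp only; linarith
    · have := (hb i j hij).1; have := hn k; simp only; linarith
  · refine ⟨fun i => - (i : ℕ) - 1, fun i j hij => ?_, fun k i j hij => ?_⟩
    · have := hc i j hij; simp only; linarith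
    · have := (hb i j hij).1; have := h0 k; simp only; linarith
  · exact ⟨fun i => 2 * (n : ℝ) * ((i : ℕ) + 1), fun i => rfl⟩

/-! ### Copies, transfer and tilings -/

namespace EdgeOrderedGraph

/-- `φ` maps the vertices of `F` onto a copy of `F` in the complete graph labeled by `ℓ`. -/
def IsCopy {V W : Type*} (F : EdgeOrderedGraph V) (ℓ : W → W → ℝ) (φ : V → W) : Prop :=
  Function.Injective φ ∧ ∀ a b c d (h : s(a, b) ∈ F.graph.edgeSet)
    (h' : s(c, d) ∈ F.graph.edgeSet), F.EdgeLT ⟨s(a, b), h⟩ ⟨s(c, d), h'⟩ →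
      ℓ (φ a) (φ b) < ℓ (φ c) (φ d)

theorem IsCopy.exists_embedding {V W : Type*} {F : EdgeOrderedGraph V}
    {L : (⊤ : SimpleGraph W).edgeSet → ℝ} {o : LinearOrder (⊤ : SimpleGraph W).edgeSet}
    (ho : ∀ e e', L e < L e' → o.lt e e') {φ : V → W} (h : F.IsCopy (edgeLabel L) φ) :
    ∃ E : Embedding F ⟨⊤, o⟩, E.verts = Set.range φ := by
  refine ⟨⟨⟨φ, fun {a b} hab => ?_⟩, h.1, ?_⟩, rfl⟩
  · exact (SimpleGraph.top_adj _ _).2 (h.1.ne hab.ne)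
  · rintro ⟨e, he⟩ ⟨e', he'⟩ hlt
    induction e with | _ a b
    induction e' with | _ c d
    have := h.2 a b c d he he' hlt
    have hab : φ a ≠ φ b := h.1.ne (SimpleGraph.Adj.ne he)
    have hcd : φ c ≠ φ d := h.1.ne (SimpleGraph.Adj.ne he')
    rw [edgeLabel_of_ne L hab, edgeLabel_of_ne L hcd] at this
    exact ho _ _ this

theorem Embedding.isCopy {V W : Type*} {F : EdgeOrderedGraph V}
    {L : (⊤ : SimpleGraph W).edgeSet → ℝ} {o : LinearOrder (⊤ : SimpleGraph W).edgeSet}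
    (ho : ∀ e e', o.lt e e' → L e < L e') (E : Embedding F ⟨⊤, o⟩) :
    F.IsCopy (edgeLabel L) E.toHom := by
  refine ⟨E.injective, fun a b c d h h' hlt => ?_⟩
  have hab : E.toHom a ≠ E.toHom b := E.injective.ne (SimpleGraph.Adj.ne h)
  have hcd : E.toHom c ≠ E.toHom d := E.injective.ne (SimpleGraph.Adj.ne h')
  rw [edgeLabel_of_ne L hab, edgeLabel_of_ne L hcd]
  exact ho _ _ (E.map_lt _ _ hlt)

/-- Two `⋆`-canonical orders of the same type and size contain the same edge-ordered graphs. -/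
theorem IsCopy.transfer {V W₁ W₂ α β : Type*} [LinearOrder α] [LinearOrder β]
    {F : EdgeOrderedGraph V} {c : CanonicalType} {p : SpecialType} {ℓ₁ : W₁ → W₁ → ℝ}
    {ℓ₂ : W₂ → W₂ → ℝ} (hℓ₁ : ∀ a b, ℓ₁ a b = ℓ₁ b a) (hℓ₂ : ∀ a b, ℓ₂ a b = ℓ₂ b a)
    {w₁ : Option α → W₁} {w₂ : Option β → W₂} {J₁ : Finset α} {J₂ : Finset β}
    (h₁ : StarOn c p ℓ₁ w₁ J₁) (h₂ : StarOn c p ℓ₂ w₂ J₂) (hJ : #J₁ = #J₂) {φ : V → W₁}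
    (hφ : F.IsCopy ℓ₁ φ) (hr : Set.range φ = w₁ '' insertNone J₁) :
    ∃ ψ : V → W₂, F.IsCopy ℓ₂ ψ ∧ Set.range ψ = w₂ '' insertNone J₂ := by
  obtain ⟨u₁, hu₁, hur₁⟩ := h₁.exists_fin hJ
  obtain ⟨u₂, hu₂, hur₂⟩ := h₂.exists_fin rfl
  have hm : ∀ o : Option (Fin #J₂), o ∈ insertNone univ := by simp
  have hi₁ : Function.Injective u₁ := fun a b => hu₁.injOn (hm a) (hm b)
  have hi₂ : Function.Injective u₂ := fun a b => hu₂.injOn (hm a) (hm b)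
  have hex : ∀ a, ∃ o, u₁ o = φ a := fun a => by
    rw [← Set.mem_range, hur₁, ← hr]
    exact Set.mem_range_self a
  choose g hg using hex
  have hgi : Function.Injective g := fun a b hab => hφ.1 (by rw [← hg, ← hg, hab])
  have hlt : ∀ a b c d, a ≠ b → c ≠ d → ℓ₁ (u₁ a) (u₁ b) < ℓ₁ (u₁ c) (u₁ d) →
      ℓ₂ (u₂ a) (u₂ b) < ℓ₂ (u₂ c) (u₂ d) := by
    intro a b a' b' hab hab' h
    obtain ⟨o, j, hoj, ho⟩ := Option.exists_oriented hab
    obtain ⟨o', k, hok, ho'⟩ := Option.exists_oriented hab'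
    have e₁ : ∀ {a b c d}, s(a, b) = s(c, d) → ℓ₁ (u₁ a) (u₁ b) = ℓ₁ (u₁ c) (u₁ d) := by
      intro a b c d h
      rcases Sym2.eq_iff.1 h with ⟨rfl, rfl⟩ | ⟨rfl, rfl⟩
      exacts [rfl, hℓ₁ _ _]
    have e₂ : ∀ {a b c d}, s(a, b) = s(c, d) → ℓ₂ (u₂ a) (u₂ b) = ℓ₂ (u₂ c) (u₂ d) := by
      intro a b c d h
      rcases Sym2.eq_iff.1 h with ⟨rfl, rfl⟩ | ⟨rfl, rfl⟩
      exacts [rfl, hℓ₂ _ _]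
    rw [e₁ ho, e₁ ho'] at h
    rw [e₂ ho, e₂ ho']
    -- Trichotomy turns the label inequality of the first order back into a comparison rule, which
    -- the second order obeys.
    rcases SpecialType.LT.trichotomy c p hoj hok with hl | ⟨rfl, rfl⟩ | hl
    · exact hu₂.lt o (hm _) j (mem_univ _) o' (hm _) k (mem_univ _) hoj hok hl
    · exact absurd h (lt_irrefl _)
    · exact absurd h
        (hu₁.lt o' (hm _) k (mem_univ _) o (hm _) j (mem_univ _) hok hoj hl).not_gt
  refine ⟨u₂ ∘ g, ⟨hi₂.comp hgi, fun a b c d h h' hl => ?_⟩, ?_⟩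
  · refine hlt _ _ _ _ (hgi.ne (SimpleGraph.Adj.ne h)) (hgi.ne (SimpleGraph.Adj.ne h')) ?_
    simp only [hg]
    exact hφ.2 a b c d h h' hl
  · have hgs : Function.Surjective g := by
      intro o
      obtain ⟨a, ha⟩ : u₁ o ∈ Set.range φ := by
        rw [hr, ← hur₁]
        exact Set.mem_range_self o
      exact ⟨a, hi₁ ((hg a).trans ha)⟩
    rw [hgs.range_comp, hur₂]

/-- `S` is a disjoint union of vertex sets of copies of `F`. -/
inductive Tiled {V W : Type*} [Fintype V] [DecidableEq W] (F : EdgeOrderedGraph V)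
    (ℓ : W → W → ℝ) : Finset W → Prop
  | empty : Tiled F ℓ ∅
  | union {S : Finset W} {φ : V → W} : Tiled F ℓ S → F.IsCopy ℓ φ →
      Disjoint S (univ.image φ) → Tiled F ℓ (S ∪ univ.image φ)

section Tiled

variable {V W : Type*} [Fintype V] [DecidableEq W] {F : EdgeOrderedGraph V} {ℓ : W → W → ℝ}

theorem IsCopy.tiled {φ : V → W} (h : F.IsCopy ℓ φ) : Tiled F ℓ (univ.image φ) := by
  simpa using Tiled.union .empty h (disjoint_empty_left _)

theorem Tiled.disjoint_union {S S' : Finset W} (h : Tiled F ℓ S) (h' : Tiled F ℓ S')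
    (hd : Disjoint S S') : Tiled F ℓ (S ∪ S') := by
  induction h' with
  | empty => simpa using h
  | union _ hφ hd' ih =>
    rw [disjoint_union_right] at hd
    rw [← union_assoc]
    exact .union (ih hd.1) hφ (disjoint_union_left.2 ⟨hd.2, hd'⟩)

theorem Tiled.card_dvd {S : Finset W} (h : Tiled F ℓ S) : Fintype.card V ∣ #S := by
  induction h with
  | empty => simp
  | union _ hφ hd ih =>
    rw [card_union_of_disjoint hd, card_image_of_injective _ hφ.1, card_univ]
    exact dvd_add ih dvd_rfl

theorem Tiled.exists_set {S : Finset W} (h : Tiled F ℓ S) : ∃ T : Set (V → W),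
    (∀ φ ∈ T, F.IsCopy ℓ φ) ∧ T.PairwiseDisjoint Set.range ∧ ⋃ φ ∈ T, Set.range φ = S := by
  induction h with
  | empty => exact ⟨∅, by simp, by simp, by simp⟩
  | @union S φ _ hφ hd ih =>
    obtain ⟨T, hT, hTd, hTu⟩ := ih
    refine ⟨insert φ T, ?_, ?_, ?_⟩
    · rintro ψ (rfl | hψ)
      exacts [hφ, hT ψ hψ]
    · refine hTd.insert fun ψ hψ _ => ?_
      have h1 : Set.range ψ ⊆ S := hTu ▸ Set.subset_biUnion_of_mem hψ
      have h2 : Set.range φ = (univ.image φ : Finset W) := by simp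
      rw [h2]
      exact (disjoint_coe.2 hd.symm).mono_right h1
    · rw [Set.biUnion_insert, hTu, coe_union, Set.union_comm]
      simp

/-- If every large set contains a copy of `F`, then all but few vertices can be tiled. -/
theorem exists_tiled_sdiff {R : ℕ}
    (hR : ∀ S : Finset W, R ≤ #S → ∃ φ : V → W, F.IsCopy ℓ φ ∧ ∀ a, φ a ∈ S)
    [Nonempty V] (S : Finset W) : ∃ U ⊆ S, #U ≤ R ∧ Tiled F ℓ (S \ U) := by
  induction S using Finset.strongInduction with
  | H S ih =>
    rcases le_total #S R with h | h
    · exact ⟨S, Subset.rfl, h, by rw [sdiff_self]; exact .empty⟩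
    obtain ⟨φ, hφ, hφS⟩ := hR S h
    have hs : univ.image φ ⊆ S := image_subset_iff.2 fun a _ => hφS a
    have hne : (univ.image φ).Nonempty := univ_nonempty.image φ
    obtain ⟨U, hU, hUR, hUt⟩ := ih (S \ univ.image φ) (sdiff_ssubset hs hne)
    refine ⟨U, hU.trans sdiff_subset, hUR, ?_⟩
    have : S \ U = (S \ univ.image φ) \ U ∪ univ.image φ := by
      ext y
      have h1 := @hU y
      have h2 := @hs y
      simp only [mem_sdiff, mem_union] at h1 h2 ⊢
      tauto
    rw [this]
    exact .union hUt hφ (disjoint_of_subset_left sdiff_subset sdiff_disjoint)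

/-- Subsets of a canonical order are canonical, so the index set can be cut into arbitrary blocks of
f vertices. -/
theorem tiled_of_canonOn {α : Type*} [LinearOrder α] {c : CanonicalType} {v : α → W}
    (hF : ∀ J : Finset α, #J = Fintype.card V → CanonOn c ℓ v J →
      ∃ φ : V → W, F.IsCopy ℓ φ ∧ univ.image φ = J.image v) {q : ℕ} {I : Finset α}
    (hI : CanonOn c ℓ v I) (hq : #I = q * Fintype.card V) : Tiled F ℓ (I.image v) := by
  induction q generalizing I with
  | zero =>
    obtain rfl : I = ∅ := card_eq_zero.1 (by simpa using hq)
    exact .empty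
  | succ q ih =>
    rw [add_one_mul] at hq
    obtain ⟨J, hJ, hJc⟩ := exists_subset_card_eq (show Fintype.card V ≤ #I by omega)
    obtain ⟨φ, hφ, hφJ⟩ := hF J hJc (hI.mono hJ)
    have h1 := ih (hI.mono sdiff_subset) (I := I \ J)
      (by rw [card_sdiff_of_subset hJ]; omega)
    rw [← sdiff_union_of_subset hJ, image_union, ← hφJ]
    refine .union h1 hφ ?_
    rw [hφJ, disjoint_left]
    simp only [mem_image, mem_sdiff]
    rintro _ ⟨i, ⟨hi, hiJ⟩, rfl⟩ ⟨j, hj, hij⟩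
    exact hiJ (hI.injOn (hJ hj) hi hij ▸ hj)

/-- The vertices of `U` can be covered by disjoint copies of `F` that use few vertices of the
canonical order. -/
theorem exists_tiled_union {α : Type*} [LinearOrder α] {c : CanonicalType} {v : α → W}
    {n N : ℕ} (hF : ∀ (I : Finset α) (x : W), CanonOn c ℓ v I → (∀ i ∈ I, v i ≠ x) → N ≤ #I →
      ∃ J ⊆ I, #J = n ∧ ∃ φ : V → W, F.IsCopy ℓ φ ∧ univ.image φ = insert x (J.image v))
    (U : Finset W) {I : Finset α} (hI : CanonOn c ℓ v I) (hU : ∀ i ∈ I, v i ∉ U)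
    (hN : N + #U * n ≤ #I) :
    ∃ J ⊆ I, Tiled F ℓ (U ∪ J.image v) := by
  induction U using Finset.induction_on generalizing I with
  | empty => exact ⟨∅, empty_subset _, by simpa using .empty⟩
  | insert x U hx ih =>
    rw [card_insert_of_notMem hx, add_one_mul] at hN
    obtain ⟨J, hJ, hJc, φ, hφ, hφJ⟩ := hF I x hI
      (fun i hi h => hU i hi (h ▸ mem_insert_self _ _)) (by omega)
    obtain ⟨J', hJ', ht⟩ := ih (I := I \ J) (hI.mono sdiff_subset)
      (fun i hi h => hU i (sdiff_subset hi) (mem_insert_of_mem h))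
      (by rw [card_sdiff_of_subset hJ]; omega)
    refine ⟨J' ∪ J, union_subset (hJ'.trans sdiff_subset) hJ, ?_⟩
    have : insert x U ∪ (J' ∪ J).image v = U ∪ J'.image v ∪ univ.image φ := by
      rw [hφJ, image_union]
      ext y
      simp only [mem_union, mem_insert]
      tauto
    rw [this]
    refine .union ht hφ ?_
    rw [hφJ, disjoint_left]
    simp only [mem_union, mem_insert, mem_image]
    rintro y (hy | ⟨i, hi, rfl⟩) (rfl | ⟨j, hj, hij⟩)
    · exact hx hy
    · exact hU j (hJ hj) (hij ▸ mem_insert_of_mem hy)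
    · exact hU i (sdiff_subset (hJ' hi)) (mem_insert_self _ _)
    · have hi' := mem_sdiff.1 (hJ' hi)
      exact hi'.2 (hI.injOn (hJ hj) hi'.1 hij ▸ hj)

end Tiled

/-- If `F` is contained in all `⋆`-canonical orders, then all large complete graphs whose order is
divisible by that of `F` can be tiled. -/
theorem exists_tiled_univ {V : Type*} [Fintype V] {F : EdgeOrderedGraph V} {n : ℕ}
    (hV : Fintype.card V = n + 1)
    (hF : ∀ (c : CanonicalType) (p : SpecialType) {W : Type} {ℓ : W → W → ℝ}
      {w : Option ℤ → W} {J : Finset ℤ}, IsLabeling ℓ → StarOn c p ℓ w J → #J = n →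
      ∃ φ : V → W, F.IsCopy ℓ φ ∧ Set.range φ = w '' insertNone J) :
    ∃ N, ∀ {W : Type} [Fintype W] [DecidableEq W] {ℓ : W → W → ℝ}, IsLabeling ℓ →
      N ≤ Fintype.card W → n + 1 ∣ Fintype.card W → Tiled F ℓ univ := by
  have : Nonempty V := Fintype.card_pos_iff.1 (by omega)
  have hcanon : ∀ (c : CanonicalType) {W : Type} [DecidableEq W] {ℓ : W → W → ℝ} {v : ℤ → W}
      (J : Finset ℤ), IsLabeling ℓ → #J = Fintype.card V → CanonOn c ℓ v J →
      ∃ φ : V → W, F.IsCopy ℓ φ ∧ univ.image φ = J.image v := by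
    intro c W _ ℓ v J hℓ hJ h
    obtain ⟨a, ha, p, hp⟩ := h.exists_starOn hℓ.symm (card_pos.1 (by omega))
    obtain ⟨φ, hφ, hr⟩ := hF c p hℓ hp (by rw [card_erase_of_mem ha]; omega)
    refine ⟨φ, hφ, coe_injective ?_⟩
    rw [image_elim_insertNone, ← Set.image_insert_eq, ← coe_insert, insert_erase ha] at hr
    simpa using hr
  -- `R` bounds the vertices left by the greedy tiling. Absorbing them uses n indices each, so a
  -- canonical set of size `N + R * n` always retains the `N` indices needed for the next one.
  obtain ⟨R, hR⟩ := exists_canonOn (n + 1)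
  obtain ⟨N, hN⟩ := exists_starOn n
  obtain ⟨M, hM⟩ := exists_canonOn (N + R * n)
  refine ⟨M, fun {W _ _ ℓ} hℓ hcard hdvd => ?_⟩
  obtain ⟨c, v, I, hIc, hI, -⟩ := hM hℓ univ hcard
  obtain ⟨U, hU, hUR, ht⟩ := exists_tiled_sdiff (F := F) (ℓ := ℓ) (R := R) (fun S hS => by
    obtain ⟨c, v, J, hJc, hJ, hJS⟩ := hR hℓ S hS
    obtain ⟨φ, hφ, hφJ⟩ := hcanon c J hℓ (hJc.trans hV.symm) hJ
    refine ⟨φ, hφ, fun a => ?_⟩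
    obtain ⟨i, hi, hia⟩ := mem_image.1 (hφJ ▸ mem_image_of_mem φ (mem_univ a))
    exact hia ▸ hJS i hi) (univ \ I.image v)
  have hUI : ∀ i ∈ I, v i ∉ U := fun i hi h =>
    (mem_sdiff.1 (hU h)).2 (mem_image_of_mem v hi)
  obtain ⟨J, hJ, ht'⟩ := exists_tiled_union (F := F) (N := N) (n := n) (fun I x hI hx hNI => by
    obtain ⟨J, hJI, hJ, p, w, J', hJ', hs, hw⟩ := hN hℓ hI hx hNI
    obtain ⟨φ, hφ, hr⟩ := hF c p hℓ hs hJ'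
    refine ⟨J, hJI, hJ, φ, hφ, coe_injective ?_⟩
    simpa [hw] using hr) U hI hUI (by rw [hIc]; gcongr)
  have hvinj : ∀ i ∈ I, v i ∈ J.image v → i ∈ J := fun i hi h => by
    obtain ⟨j, hj, hji⟩ := mem_image.1 h
    exact hI.injOn (hJ hj) hi hji ▸ hj
  have ht₂ := ht.disjoint_union ht' (by
    rw [disjoint_left]
    intro y hy hy'
    rw [mem_sdiff, mem_sdiff] at hy
    rcases mem_union.1 hy' with h | h
    exacts [hy.2 h, hy.1.2 (image_subset_image hJ h)])
  have huniv : univ = (univ \ I.image v) \ U ∪ (U ∪ J.image v) ∪ (I \ J).image v := by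
    ext y
    simp only [mem_univ, mem_union, mem_sdiff, true_and, true_iff]
    by_cases h : y ∈ I.image v
    · obtain ⟨i, hi, rfl⟩ := mem_image.1 h
      by_cases hiJ : i ∈ J
      · exact .inl (.inr (.inr (mem_image_of_mem v hiJ)))
      · exact .inr (mem_image_of_mem v (mem_sdiff.2 ⟨hi, hiJ⟩))
    · tauto
  have hd : Disjoint ((univ \ I.image v) \ U ∪ (U ∪ J.image v)) ((I \ J).image v) := by
    rw [disjoint_right]
    intro y hy hy'
    obtain ⟨i, hi, rfl⟩ := mem_image.1 hy
    obtain ⟨hi, hiJ⟩ := mem_sdiff.1 hi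
    rcases mem_union.1 hy' with h | h
    · exact (mem_sdiff.1 (mem_sdiff.1 h).1).2 (mem_image_of_mem v hi)
    · rcases mem_union.1 h with h | h
      exacts [hUI i hi h, hiJ (hvinj i hi h)]
  -- Everything else is already tiled and the total is divisible by f, hence so is the unused part
  -- of the canonical set.
  have hdvd' : Fintype.card V ∣ #(I \ J) := by
    rw [← card_image_of_injOn (hI.injOn.mono (coe_subset.2 sdiff_subset) : Set.InjOn v ↑(I \ J)),
      ← Nat.dvd_add_right ht₂.card_dvd, ← card_union_of_disjoint hd, ← huniv, card_univ, hV]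
    exact hdvd
  obtain ⟨q, hq⟩ := hdvd'
  rw [huniv]
  exact ht₂.disjoint_union (tiled_of_canonOn (fun J hJ h => hcanon c J hℓ hJ h)
    (hI.mono sdiff_subset) (hq.trans (mul_comm _ _))) hd

end EdgeOrderedGraph

/-! ### The characterization -/

theorem exists_injective_lt_iff {α : Type*} [Fintype α] (o : LinearOrder α) :
    ∃ L : α → ℝ, Function.Injective L ∧ ∀ e e', o.lt e e' ↔ L e < L e' := by
  let f := Fintype.orderIsoFinOfCardEq α rfl
  refine ⟨fun e => ((f.symm e : ℕ) : ℝ), fun a b h => ?_, fun e e' => ?_⟩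
  · exact f.symm.injective (Fin.ext (Nat.cast_injective h))
  · rw [Nat.cast_lt, Fin.val_fin_lt, f.symm.lt_iff_lt]

theorem theorem2p4 {V : Type*} [Fintype V] (F : EdgeOrderedGraph V) (n : ℕ)
    (hF : Fintype.card V = n + 1) :
    F.Tileable ↔
      ∀ (c : CanonicalType) (p : SpecialType) (L : (starGraph n).edgeSet → ℝ)
        (hL : Function.Injective L), IsStarCanonical c p L →
          (EdgeOrderedGraph.ofLabeling (starGraph n) L hL).Contains F := by
  classical
  constructor
  · rintro ⟨t, ht, hdvd, htile⟩ c p L hL hLc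
    obtain ⟨m, rfl⟩ : ∃ m, t = m + 1 := ⟨t - 1, by omega⟩
    obtain ⟨L', hL'⟩ := exists_isStarCanonical m c p
    let σ : Fin (m + 1) ≃ Option (Fin m) := finSuccEquiv m
    let e : (⊤ : SimpleGraph (Fin (m + 1))) ≃g starGraph m := SimpleGraph.Iso.completeGraph σ
    let L₀ : (⊤ : SimpleGraph (Fin (m + 1))).edgeSet → ℝ := fun a => L' (e.mapEdgeSet a)
    have hL₀ : Function.Injective L₀ := hL'.injective.comp e.mapEdgeSet.injective
    obtain ⟨T, hTd, hTu⟩ := htile (LinearOrder.lift' L₀ hL₀)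
    -- Only the tile that covers the special vertex is needed.
    have hmem : σ.symm none ∈ ⋃ φ ∈ T, φ.verts := hTu ▸ Set.mem_univ _
    simp only [Set.mem_iUnion] at hmem
    obtain ⟨E, -, a, ha⟩ := hmem
    have hE := E.isCopy (L := L₀) fun _ _ h => h
    have hE' : F.IsCopy (edgeLabel L') (σ ∘ E.toHom) := by
      refine ⟨σ.injective.comp hE.1, fun a b c d h h' hl => ?_⟩
      have := hE.2 a b c d h h' hl
      have hab := hE.1.ne (SimpleGraph.Adj.ne h)
      have hcd := hE.1.ne (SimpleGraph.Adj.ne h')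
      rw [edgeLabel_of_ne L₀ hab, edgeLabel_of_ne L₀ hcd] at this
      simp only [Function.comp_apply]
      rw [edgeLabel_of_ne L' (σ.injective.ne hab), edgeLabel_of_ne L' (σ.injective.ne hcd)]
      exact this
    have hnone : none ∈ univ.image (σ ∘ E.toHom) :=
      mem_image.2 ⟨a, mem_univ _, by simp [ha]⟩
    set J := eraseNone (univ.image (σ ∘ E.toHom)) with hJ
    have hins : insertNone J = univ.image (σ ∘ E.toHom) := by
      rw [hJ, insertNone_eraseNone, insert_eq_of_mem hnone]
    have hJc : #J = n := by
      have := card_insertNone J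
      rw [hins, card_image_of_injective _ hE'.1, card_univ, hF] at this
      omega
    obtain ⟨ψ, hψ, -⟩ := hE'.transfer (edgeLabel_symm L') (edgeLabel_symm L)
      (hL'.starOn.mono (subset_univ J)) hLc.starOn (by simp [hJc])
      (by rw [hins, Set.image_id, coe_image, coe_univ, Set.image_univ])
    obtain ⟨E', -⟩ := hψ.exists_embedding (o := LinearOrder.lift' L hL) fun _ _ h => h
    exact ⟨E'⟩
  · intro H
    obtain ⟨N, hN⟩ := EdgeOrderedGraph.exists_tiled_univ (F := F) hF
      fun c p {W ℓ w J} hℓ hs hJ => by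
        obtain ⟨L, hL⟩ := exists_isStarCanonical n c p
        obtain ⟨E⟩ := H c p L hL.injective hL
        have hE := EdgeOrderedGraph.Embedding.isCopy (L := L)
          (o := LinearOrder.lift' L hL.injective) (fun _ _ h => h) E
        refine hE.transfer (edgeLabel_symm L) hℓ.symm hL.starOn hs (by simp [hJ]) ?_
        -- F has as many vertices as the ⋆-canonical graph, so its copy is spanning, as the transfer
        -- requires.
        have hb : Function.Bijective E.toHom :=
          (Fintype.bijective_iff_injective_and_card _).2 ⟨hE.1, by simp [hF]⟩
        exact hb.2.range_eq.trans (by ext y; simp)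
    -- A positive multiple of f that is at least `N`, even when `N` is 0.
    refine ⟨(n + 1) * (N + 1), by positivity, hF ▸ dvd_mul_right _ _, fun o => ?_⟩
    obtain ⟨L, hL, hLo⟩ := exists_injective_lt_iff o
    obtain ⟨T, hT, hTd, hTu⟩ := (hN (isLabeling_edgeLabel hL)
      (by rw [Fintype.card_fin]; nlinarith) (by simp)).exists_set
    choose E hE using fun φ : T => (hT φ φ.2).exists_embedding fun e e' => (hLo e e').2
    refine ⟨Set.range E, ?_, ?_⟩
    · rintro _ ⟨φ, rfl⟩ _ ⟨ψ, rfl⟩ hne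
      simp only [Function.onFun, hE]
      exact hTd φ.2 ψ.2 fun h => hne (by rw [Subtype.ext h])
    · rw [Set.biUnion_range, Set.iUnion_congr hE, ← Set.biUnion_eq_iUnion T fun φ _ => Set.range φ,
        hTu, coe_univ]
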